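/- **Setting.** A DC microgrid is a connected undirected simple graph whose $n$ nodes are partitioned into a nonempty finite set $\mathcal V_s$ of $n_s$ sources and a nonempty finite set $\mathcal V_l$ of $n_l$ loads; its edges carry resistances $r_k>0$. Let $B$ be an oriented incidence matrix, $\Gamma=\mathrm{diag}(r_k^{-1})$ and $$Y=B\Gamma B^T=\begin{bmatrix}Y_{ss}&Y_{sl}\\Y_{ls}&Y_{ll}\end{bmatrix}.$$ Let $L_c$ be the Laplacian of a connected undirected unweighted communication graph on $\mathcal V_s$ and $C_s=\mathrm{diag}(C_i)$ with $C_i>0$. For a vector $v$, $[v]$ is the diagonal matrix with diagonal $v$, and $\mathbb 1$ is the all-ones vector. The loads are ZI loads, $I_l(V_l)=I_l^*-Y_l^*V_l$, where $I_l^*\le 0$ entrywise, $Y_l^*\ge 0$ is diagonal, and at every load the constant current or the conductance is nonzero. With $V=\mathrm{col}(V_s,V_l)\in\mathbb R^n$ and $P_s=P_s(V)=[V_s](Y_{ss}V_s+Y_{sl}V_l)$, the closed-loop system is $$C_s\dot V_s=-[V_s]L_cC_s^{-1}P_s,\qquad I_l(V_l)=Y_{ls}V_s+Y_{ll}V_l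 .\tag{1}$$ Let $\mathcal E_{ZI}$ be the set of $V\in\mathbb R^n_{>0}$ with $V_l=(Y_{ll}+Y_l^*)^{-1}(I_l^*-Y_{ls}V_s)$ and $$[V_s]\hat Y_{red}V_s+[V_s]Y_{sl}(Y_{ll}+Y_l^*)^{-1}I_l^*-C_s\mathbb 1p_s^*=0,$$ where $\hat Y_{red}=Y_{ss}-Y_{sl}(Y_{ll}+Y_l^*)^{-1}Y_{ls}$ and $$p_s^*=-\frac{\mathbb 1^T\big(I_l^*-Y_l^*(Y_{ll}+Y_l^*)^{-1}(I_l^*-Y_{ls}V_s)\big)}{\mathbb 1^T[V_s]^{-1}C_s\mathbb 1}.$$ Assume $\mathcal E_{ZI}\neq\emptyset$, fix $\overline V\in\mathcal E_{ZI}$, put $\overline P_s=P_s(\overline V)$, and for $V_s>0$ let $$M(V)=\tfrac12V^T\Big(Y+\begin{bmatrix}0&0\\0&Y_l^*\end{bmatrix}\Big)V-\sum_{i\in\mathcal V_s}\overline P_{s,i}\ln V_i,\qquad \mathcal M(V)=M(V)-M(\overline V)-\nabla M(\overline V)^T(V-\overline V).$$ For $c\in\mathbb R$ let $\Lambda_c=\{V\in\mathbb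 R^n: V_s>0,\ \mathcal M(V)\le c\}$. **Theorem.** There is $c>0$ such that $\Lambda_c$ is compact and contained in $\mathbb R^n_{>0}$. Moreover, let $\Lambda_{ZI}=\Lambda_c$ be any sublevel set of $\mathcal M$ with $\Lambda_{ZI}\subset\mathbb R^n_{>0}$, and let $V(0)\in\Lambda_{ZI}$ satisfy the load equation in (1). Then the solution of (1) starting at $V(0)$ exists on $[0,\infty)$ and is unique, it remains in $\Lambda_{ZI}$ for all $t\ge 0$, and it converges as $t\to\infty$ to a single point $V^\infty\in\mathcal E_{ZI}\cap\Lambda_{ZI}\cap\mathcal V_{ZI}$ (depending on $V(0)$), where $$\mathcal V_{ZI}=\Big\{V\in\Lambda_{ZI}:\ \prod_{i\in\mathcal V_s}V_i^{C_i}=\prod_{i\in\mathcal V_s}V_i(0)^{C_i},\ V_l=(Y_{ll}+Y_l^*)^{-1}(I_l^*-Y_{ls}V_s)\Big\}.$$ The point $V^\infty$ is an equilibrium of (1) that is asymptotically stable in the following sense: it is Lyapunov stable with respect to all solutions of (1), and it attracts every solution of (1) on $[0,\infty)$ that starts sufficiently close to it with the same value of the conserved weighted geometric mean, i.e. with $\prod_{i\in\mathcal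 V_s}V_i(0)^{C_i}=\prod_{i\in\mathcal V_s}(V_i^\infty)^{C_i}$. -/

import Mathlib

open Set Filter Topology
open scoped Matrix

/-- A DC resistive microgrid with source buses `S`, load buses `L` and ZI loads, together with the
communication graph and the weights of the power consensus controllers. -/
structure Microgrid (S L : Type*) where
  /-- the electrical network: nodes are the buses, edges are the lines -/
  graph : SimpleGraph (S ⊕ L)
  graph_connected : graph.Connected
  /-- an arbitrary orientation of the lines, used to write the incidence matrix -/
  tail : graph.edgeSet → S ⊕ L
  head : graph.edgeSet → S ⊕ L
  orientation : ∀ e : graph.edgeSet, s(tail e, head e) = (e : Sym2 (S ⊕ L))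
  /-- line resistances -/
  r : graph.edgeSet → ℝ
  r_pos : ∀ e, 0 < r e
  /-- the (undirected, unweighted) communication graph of the sources -/
  comm : SimpleGraph S
  comm_connected : comm.Connected
  /-- controller parameters -/
  C : S → ℝ
  C_pos : ∀ i, 0 < C i
  /-- constant load currents `I_l^*` -/
  Il : L → ℝ
  /-- load conductances, the diagonal of `Y_l^*` -/
  Yl : L → ℝ
  Il_nonpos : ∀ j, Il j ≤ 0
  Yl_nonneg : ∀ j, 0 ≤ Yl j
  load_nonzero : ∀ j, Il j < 0 ∨ 0 < Yl j

namespace Microgrid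

noncomputable section

variable {S L : Type*} [Fintype S] [Fintype L] [DecidableEq S] [DecidableEq L]
  (N : Microgrid S L)

/-- Oriented incidence matrix `B`. -/
def B : Matrix (S ⊕ L) N.graph.edgeSet ℝ := fun i e =>
  (if i = N.tail e then 1 else 0) - (if i = N.head e then 1 else 0)

open Classical in
/-- The conductance matrix `Y = B Γ Bᵀ`, where `Γ = diag (1 / r)`. -/
def Y : Matrix (S ⊕ L) (S ⊕ L) ℝ :=
  N.B * Matrix.diagonal (fun e => (N.r e)⁻¹) * N.Bᵀ

def Yss : Matrix S S ℝ := N.Y.toBlocks₁₁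
def Ysl : Matrix S L ℝ := N.Y.toBlocks₁₂
def Yls : Matrix L S ℝ := N.Y.toBlocks₂₁
def Yll : Matrix L L ℝ := N.Y.toBlocks₂₂

/-- The diagonal matrix `Y_l^*` of load conductances. -/
def YlMat : Matrix L L ℝ := Matrix.diagonal N.Yl

open Classical in
/-- Laplacian `L_c` of the communication graph. -/
def Lc : Matrix S S ℝ := N.comm.lapMatrix ℝ

/-- The open positive orthant `ℝⁿ_{>0}`. -/
def posOrthant (S L : Type*) : Set (S ⊕ L → ℝ) := {V | ∀ k, 0 < V k}

/-- Source voltages of `V = col (V_s, V_l)`. -/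
def src (V : S ⊕ L → ℝ) : S → ℝ := fun i => V (Sum.inl i)

/-- Load voltages of `V = col (V_s, V_l)`. -/
def ld (V : S ⊕ L → ℝ) : L → ℝ := fun j => V (Sum.inr j)

/-- Source power injections `P_s = [V_s] (Y_ss V_s + Y_sl V_l)`. -/
def Ps (V : S ⊕ L → ℝ) : S → ℝ := fun i =>
  src V i * (N.Yss *ᵥ src V + N.Ysl *ᵥ ld V) i

/-- ZI load currents `I_l(V_l) = I_l^* - Y_l^* V_l`. -/
def loadCurrent (Vl : L → ℝ) : L → ℝ := N.Il - N.YlMat *ᵥ Vl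

/-- The algebraic equation at the loads, `I_l(V_l) = B_l Γ Bᵀ V = Y_ls V_s + Y_ll V_l`. -/
def LoadBalance (V : S ⊕ L → ℝ) : Prop :=
  N.loadCurrent (ld V) = N.Yls *ᵥ src V + N.Yll *ᵥ ld V

/-- The right-hand side `-[V_s] L_c C_s⁻¹ P_s` of the source dynamics. -/
def sourceRHS (V : S ⊕ L → ℝ) : S → ℝ := fun i =>
  -(src V i * (N.Lc *ᵥ fun k => (N.C k)⁻¹ * N.Ps V k) i)

/-- `V` solves the closed-loop differential-algebraic system on the time interval `J`:
`C_s V̇_s = -[V_s] L_c C_s⁻¹ P_s` together with the load equation. -/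
structure IsSolution (J : Set ℝ) (V : ℝ → S ⊕ L → ℝ) : Prop where
  source : ∀ t ∈ J, ∀ i : S,
    HasDerivWithinAt (fun τ => N.C i * src (V τ) i) (N.sourceRHS (V t) i) J t
  load : ∀ t ∈ J, N.LoadBalance (V t)

/-- Equilibrium of the closed-loop system. -/
def IsEquilibrium (V : S ⊕ L → ℝ) : Prop :=
  V ∈ posOrthant S L ∧ N.sourceRHS V = 0 ∧ N.LoadBalance V

/-- `(Y_ll + Y_l^*)⁻¹ (I_l^* - Y_ls V_s)`. -/
def loadVoltage (Vs : S → ℝ) : L → ℝ :=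
  (N.Yll + N.YlMat)⁻¹ *ᵥ (N.Il - N.Yls *ᵥ Vs)

/-- Kron-reduced conductance matrix absorbing the impedance loads. -/
def YredHat : Matrix S S ℝ := N.Yss - N.Ysl * (N.Yll + N.YlMat)⁻¹ * N.Yls

/-- The scalar `p_s^*`: minus the total load current over `𝟙ᵀ [V_s]⁻¹ C_s 𝟙`. -/
def psStar (Vs : S → ℝ) : ℝ :=
  -(∑ j, (N.Il - N.YlMat *ᵥ N.loadVoltage Vs) j) / ∑ i, (Vs i)⁻¹ * N.C i

/-- Power balance at the sources. -/
def powerBalance (Vs : S → ℝ) : S → ℝ := fun i =>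
  Vs i * (N.YredHat *ᵥ Vs) i + Vs i * (N.Ysl *ᵥ ((N.Yll + N.YlMat)⁻¹ *ᵥ N.Il)) i
    - N.C i * N.psStar Vs

/-- The set `𝓔_ZI`. -/
def equilibria : Set (S ⊕ L → ℝ) :=
  {V | V ∈ posOrthant S L ∧ N.powerBalance (src V) = 0 ∧ ld V = N.loadVoltage (src V)}

/-- Power losses at passive devices, `J(V) = ½ Vᵀ (B Γ Bᵀ + diag (0, Y_l^*)) V`. -/
def losses (V : S ⊕ L → ℝ) : ℝ :=
  (1 / 2) * (V ⬝ᵥ ((N.Y + Matrix.fromBlocks 0 0 0 N.YlMat) *ᵥ V))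

/-- The energy function `M(V) = J(V) - P̄_sᵀ ln V_s`, with `P̄_s` the source powers at `Vbar`. -/
def energy (Vbar V : S ⊕ L → ℝ) : ℝ :=
  N.losses V - ∑ i, N.Ps Vbar i * Real.log (src V i)

/-- The shifted (Bregman) function `𝓜`, centred at `Vbar`. -/
def bregman (Vbar V : S ⊕ L → ℝ) : ℝ :=
  N.energy Vbar V - N.energy Vbar Vbar - fderiv ℝ (N.energy Vbar) Vbar (V - Vbar)

/-- The sublevel set of `𝓜` at level `c`. The function `𝓜` contains the logarithms of the source
voltages only, so its domain is `V_s > 0`; the load voltages are not restricted here. -/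
def sublevel (Vbar : S ⊕ L → ℝ) (c : ℝ) : Set (S ⊕ L → ℝ) :=
  {V | (∀ i, 0 < src V i) ∧ N.bregman Vbar V ≤ c}

/-- States with the same weighted geometric mean of the source voltages as `V0`. -/
def leaf (V0 : S ⊕ L → ℝ) : Set (S ⊕ L → ℝ) :=
  {V | ∏ i, src V i ^ N.C i = ∏ i, src V0 i ^ N.C i}

/-- The set `𝓥_ZI` (within a given sublevel set `Λ`) attached to the initial condition `V0`. -/
def preserved (Λ : Set (S ⊕ L → ℝ)) (V0 : S ⊕ L → ℝ) : Set (S ⊕ L → ℝ) :=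
  {V | V ∈ Λ ∧ V ∈ N.leaf V0 ∧ ld V = N.loadVoltage (src V)}

/-- Lyapunov stability, with respect to all solutions of the closed-loop system. -/
def LyapunovStable (Ve : S ⊕ L → ℝ) : Prop :=
  ∀ ε > 0, ∃ δ > 0, ∀ (T : ℝ) (V : ℝ → S ⊕ L → ℝ), N.IsSolution (Ico 0 T) V →
    dist (V 0) Ve < δ → ∀ t ∈ Ico 0 T, dist (V t) Ve < ε

/-- `Ve` is an equilibrium that is Lyapunov stable (with respect to all solutions) and attracts
every solution that starts close to it with the same weighted geometric mean of the source
voltages. That mean is a conserved quantity, so no equilibrium attracts a full neighbourhood. -/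
def AsymptoticallyStable (Ve : S ⊕ L → ℝ) : Prop :=
  N.IsEquilibrium Ve ∧ N.LyapunovStable Ve ∧
    ∃ δ > 0, ∀ V : ℝ → S ⊕ L → ℝ, N.IsSolution (Ici 0) V →
      V 0 ∈ N.leaf Ve → dist (V 0) Ve < δ → Tendsto V atTop (𝓝 Ve)

end

end Microgrid

/-! The load equation is affine with an invertible matrix, so the loads are functions of the
sources. In the coordinates `u = ln V_s` the system becomes the ODE `u' = -C⁻¹ L_c C⁻¹ P_s`. The
gradient of `𝓜` in these coordinates is `P_s - P̄_s` (`fderiv_bregman_ofLog`). At an equilibrium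
`P̄_s = C p`, and constants lie in the kernel of `L_c`, so `𝓜` has orbital derivative `-zᵀ L_c z ≤
0` with `z = C⁻¹ P_s` (`fderiv_bregman_logField`).

`𝓜` is a nonnegative quadratic form plus multiples `P̄_i > 0` of `exp y - 1 - y`, where `y` is a log
ratio of source voltages. Its sublevel sets are therefore compact in the logarithms too
(`isCompact_bregman_ofLog_le`), which gives global solutions with positive sources. The mean value
theorem supplies a limit point where the orbital derivative vanishes. The communication graph is
connected, so all `z i` agree there and the limit point is an equilibrium.

Convergence to a single point follows by recentring: `𝓜` centred at the limit point is again a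
Lyapunov function, and its sublevel sets shrink to that point, so an orbit entering one never leaves
it. The same sublevel sets give Lyapunov stability. Attraction within a leaf holds because a leaf
contains at most one equilibrium (`eq_of_mem_equilibria_of_mem_leaf`). -/

set_option linter.unusedSectionVars false

/-! ### Autonomous differential equations and Lyapunov functions. -/

section Dynamics

variable {E : Type*} [NormedAddCommGroup E] [NormedSpace ℝ E]

/-- A bounded, globally Lipschitz autonomous vector field has a complete integral curve through
every point. -/
theorem LipschitzWith.exists_global_solution [CompleteSpace E] {f : E → E} {K M : NNReal}
    (hf : LipschitzWith K f) (hM : ∀ x, ‖f x‖ ≤ M) (x₀ : E) :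
    ∃ u : ℝ → E, u 0 = x₀ ∧ ∀ t, HasDerivAt u (f (u t)) t := by
  have hloc : ∀ n : ℕ, ∃ α : ℝ → E, α 0 = x₀ ∧
      ∀ t ∈ Icc (-((n : ℝ) + 1)) (n + 1),
        HasDerivWithinAt α (f (α t)) (Icc (-((n : ℝ) + 1)) (n + 1)) t := by
    intro n
    have hmem : (0 : ℝ) ∈ Icc (-((n : ℝ) + 1)) (n + 1) := by
      constructor <;> linarith [n.cast_nonneg (α := ℝ)]
    -- In time `n + 1` a curve of speed at most `M` stays in the ball of radius `M * (n + 1)`.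
    have hPL : IsPicardLindelof (fun _ => f) ⟨0, hmem⟩ x₀ (M * (n + 1)) 0 M K :=
      { lipschitzOnWith := fun t _ => hf.lipschitzOnWith
        continuousOn := fun x _ => continuousOn_const
        norm_le := fun t _ x _ => hM x
        mul_max_le := by simp }
    exact hPL.exists_eq_forall_mem_Icc_hasDerivWithinAt₀
  choose α hα0 hα using hloc
  have hderiv : ∀ n : ℕ, ∀ t ∈ Ioo (-((n : ℝ) + 1)) (n + 1), HasDerivAt (α n) (f (α n t)) t :=
    fun n t ht => (hα n t (Ioo_subset_Icc_self ht)).hasDerivAt (Icc_mem_nhds ht.1 ht.2)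
  have hagree : ∀ m n : ℕ, m ≤ n → ∀ t ∈ Ioo (-((m : ℝ) + 1)) (m + 1), α m t = α n t := by
    intro m n hmn
    have hmn' : (m : ℝ) ≤ n := by exact_mod_cast hmn
    refine ODE_solution_unique_of_mem_Ioo (v := fun _ => f) (s := fun _ => univ) (K := K)
      (t₀ := 0) (fun t _ => hf.lipschitzOnWith) ?_ (fun t ht => ⟨hderiv m t ht, mem_univ _⟩)
      (fun t ht => ⟨hderiv n t ⟨by linarith [ht.1], by linarith [ht.2]⟩, mem_univ _⟩)
      (by rw [hα0, hα0])
    constructor <;> linarith [m.cast_nonneg (α := ℝ)]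
  have hval : ∀ (n : ℕ) (t : ℝ), |t| < n + 1 → α ⌈|t|⌉₊ t = α n t := by
    intro n t ht
    have h1 := abs_lt.1 ht
    have h2 : |t| < (⌈|t|⌉₊ : ℝ) + 1 := (Nat.le_ceil _).trans_lt (lt_add_one _)
    rcases le_total ⌈|t|⌉₊ n with h | h
    · exact hagree _ _ h t (by have := abs_lt.1 h2; exact ⟨this.1, this.2⟩)
    · exact (hagree _ _ h t ⟨h1.1, h1.2⟩).symm
  -- The half-width is the index plus one, so `t` is an interior point, and near `t` the glued curve
  -- is one fixed `α n`.
  refine ⟨fun t => α ⌈|t|⌉₊ t, by simp [hα0], fun t => ?_⟩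
  have hlt : |t| < (⌈|t|⌉₊ : ℝ) + 1 := (Nat.le_ceil _).trans_lt (lt_add_one _)
  have h1 := abs_lt.1 hlt
  refine (hderiv ⌈|t|⌉₊ t ⟨h1.1, h1.2⟩).congr_of_eventuallyEq ?_
  have : ∀ᶠ s in 𝓝 t, |s| < (⌈|t|⌉₊ : ℝ) + 1 :=
    (continuous_abs.tendsto t).eventually_lt_const hlt
  filter_upwards [this] with s hs using hval _ s hs

/-- If `m` does not increase along the flow of a `C¹` vector field and has compact sublevel sets,
then solutions exist for all positive times and stay in the sublevel set of their initial
condition. -/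
theorem exists_forward_solution_of_lyapunov [FiniteDimensional ℝ E] {f : E → E}
    (hf : ContDiff ℝ 1 f) {m : E → ℝ} (hm : Differentiable ℝ m)
    (hle : ∀ x, fderiv ℝ m x (f x) ≤ 0) {x₀ : E} (hK : IsCompact {x | m x ≤ m x₀}) :
    ∃ u : ℝ → E, u 0 = x₀ ∧ (∀ t, 0 ≤ t → HasDerivAt u (f (u t)) t) ∧
      ∀ t, 0 ≤ t → m (u t) ≤ m x₀ := by
  obtain ⟨R, hR0, hR⟩ := hK.isBounded.subset_closedBall_lt 0 (0 : E)
  -- The cutoff makes the field bounded and Lipschitz. Since `χ ≥ 0`, `m` still decreases along it,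
  -- so the orbit stays where `χ = 1` and solves the original equation.
  let χ : ContDiffBump (0 : E) := ⟨R, R + 1, hR0, lt_add_one R⟩
  have hg : ContDiff ℝ 1 (fun x => χ x • f x) := χ.contDiff.smul hf
  have hsupp : HasCompactSupport (fun x => χ x • f x) := χ.hasCompactSupport.smul_right
  obtain ⟨K, hKL⟩ := hg.lipschitzWith_of_hasCompactSupport hsupp one_ne_zero
  obtain ⟨M, hM⟩ := hsupp.exists_bound_of_continuous hg.continuous
  obtain ⟨u, hu0, hu⟩ := hKL.exists_global_solution (M := M.toNNReal)
    (fun x => (hM x).trans (Real.le_coe_toNNReal M)) x₀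
  have hd : ∀ t, HasDerivAt (fun τ => m (u τ)) (fderiv ℝ m (u t) (χ (u t) • f (u t))) t :=
    fun t => (hm (u t)).hasFDerivAt.comp_hasDerivAt t (hu t)
  have hanti : Antitone fun τ => m (u τ) := by
    refine antitone_of_hasDerivAt_nonpos hd fun t => ?_
    simp only [map_smul, smul_eq_mul, Pi.zero_apply]
    exact mul_nonpos_of_nonneg_of_nonpos χ.nonneg (hle _)
  have hmem : ∀ t, 0 ≤ t → m (u t) ≤ m x₀ := fun t ht => by simpa [hu0] using hanti ht
  refine ⟨u, hu0, fun t ht => ?_, hmem⟩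
  have h1 : χ (u t) = 1 := χ.one_of_mem_closedBall (hR (hmem t ht))
  simpa [h1] using hu t

/-- A solution that stays in a compact set has a limit point at which the orbital derivative of
a Lyapunov function vanishes. -/
theorem exists_limit_point_orbital_deriv_eq_zero {f : E → E} {m : E → ℝ}
    (hm : Differentiable ℝ m) (hle : ∀ x, fderiv ℝ m x (f x) ≤ 0)
    (hcont : Continuous fun x => fderiv ℝ m x (f x)) {u : ℝ → E}
    (hu : ∀ t, 0 ≤ t → HasDerivAt u (f (u t)) t) {K : Set E} (hK : IsCompact K)
    (huK : ∀ t, 0 ≤ t → u t ∈ K) :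
    ∃ x ∈ K, fderiv ℝ m x (f x) = 0 ∧
      ∃ s : ℕ → ℝ, Tendsto s atTop atTop ∧ Tendsto (fun n => u (s n)) atTop (𝓝 x) := by
  obtain ⟨b, hb⟩ := hK.exists_bound_of_continuousOn hm.continuous.continuousOn
  have hd : ∀ t, 0 ≤ t → HasDerivAt (fun τ => m (u τ)) (fderiv ℝ m (u t) (f (u t))) t :=
    fun t ht => (hm (u t)).hasFDerivAt.comp_hasDerivAt t (hu t ht)
  have hslow : ∀ n : ℕ, ∃ s : ℝ, (n : ℝ) ≤ s ∧
      -(2 * b) / ((n : ℝ) + 1) ≤ fderiv ℝ m (u s) (f (u s)) := by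
    intro n
    have hn : (0 : ℝ) ≤ n := n.cast_nonneg
    -- On an interval of length `n + 1` the bounded function `m ∘ u` drops by at most `2 * b`, so
    -- its slope is nearly zero somewhere.
    obtain ⟨s, hs, hs'⟩ := exists_hasDerivAt_eq_slope (fun τ => m (u τ))
      (fun t => fderiv ℝ m (u t) (f (u t))) (a := n) (b := n + (n + 1)) (by linarith)
      (fun t ht => (hd t (hn.trans ht.1)).continuousAt.continuousWithinAt)
      (fun t ht => hd t (hn.trans ht.1.le))
    refine ⟨s, hs.1.le, ?_⟩
    rw [hs', add_sub_cancel_left]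
    have h1 := abs_le.1 (hb _ (huK n hn))
    have h2 := abs_le.1 (hb _ (huK (n + (n + 1)) (by linarith)))
    gcongr
    linarith
  choose s hs hslow using hslow
  obtain ⟨x, hx, φ, hφ, hlim⟩ := hK.tendsto_subseq (x := fun n => u (s n))
    fun n => huK _ (n.cast_nonneg.trans (hs n))
  have hs_top : Tendsto s atTop atTop := tendsto_atTop_mono hs tendsto_natCast_atTop_atTop
  refine ⟨x, hx, ?_, s ∘ φ, hs_top.comp hφ.tendsto_atTop, hlim⟩
  have h1 : Tendsto (fun n : ℕ => -(2 * b) / ((n : ℝ) + 1)) atTop (𝓝 0) :=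
    tendsto_const_nhds.div_atTop (tendsto_atTop_add_const_right _ _ tendsto_natCast_atTop_atTop)
  have h2 : Tendsto (fun n => fderiv ℝ m (u (s n)) (f (u (s n)))) atTop (𝓝 0) :=
    tendsto_of_tendsto_of_tendsto_of_le_of_le h1 tendsto_const_nhds hslow fun n => hle _
  exact tendsto_nhds_unique ((hcont.tendsto x).comp hlim) (h2.comp hφ.tendsto_atTop)

/-- Uniqueness of forward solutions of an autonomous equation with a `C¹` right-hand side. -/
theorem ContDiff.eqOn_Ico_of_hasDerivWithinAt [FiniteDimensional ℝ E] {f : E → E}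
    (hf : ContDiff ℝ 1 f) {u w : ℝ → E} {T : ℝ}
    (hu : ∀ t ∈ Ico 0 T, HasDerivWithinAt u (f (u t)) (Ico 0 T) t)
    (hw : ∀ t ∈ Ico 0 T, HasDerivWithinAt w (f (w t)) (Ico 0 T) t) (h0 : u 0 = w 0) :
    EqOn u w (Ico 0 T) := by
  intro T' hT'
  have hsub : Icc 0 T' ⊆ Ico 0 T := fun t ht => ⟨ht.1, ht.2.trans_lt hT'.2⟩
  have hcont : ∀ v : ℝ → E, (∀ t ∈ Ico 0 T, HasDerivWithinAt v (f (v t)) (Ico 0 T) t) →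
      ContinuousOn v (Icc 0 T') := fun v hv t ht =>
    ((hv t (hsub ht)).continuousWithinAt).mono hsub
  have hright : ∀ v : ℝ → E, (∀ t ∈ Ico 0 T, HasDerivWithinAt v (f (v t)) (Ico 0 T) t) →
      ∀ t ∈ Ico 0 T', HasDerivWithinAt v (f (v t)) (Ici t) t := fun v hv t ht => by
    refine (hv t (hsub (Ico_subset_Icc_self ht))).mono_of_mem_nhdsWithin ?_
    refine mem_of_superset (Ico_mem_nhdsGE (ht.2.trans hT'.2)) (Ico_subset_Ico_left ht.1)
  have hcu := hcont u hu
  have hcw := hcont w hw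
  -- Both arcs lie in one compact ball, where the locally Lipschitz field is Lipschitz.
  obtain ⟨R, hR⟩ := ((isCompact_Icc.image_of_continuousOn hcu).union
    (isCompact_Icc.image_of_continuousOn hcw)).isBounded.subset_closedBall (0 : E)
  obtain ⟨K, hK⟩ := (hf.locallyLipschitz.locallyLipschitzOn
    (s := Metric.closedBall (0 : E) R)).exists_lipschitzOnWith_of_compact
      (isCompact_closedBall _ _)
  exact ODE_solution_unique_of_mem_Icc_right (v := fun _ => f)
    (s := fun _ => Metric.closedBall (0 : E) R) (fun t _ => hK) hcu (hright u hu)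
    (fun t ht => hR (Or.inl (mem_image_of_mem u (Ico_subset_Icc_self ht)))) hcw (hright w hw)
    (fun t ht => hR (Or.inr (mem_image_of_mem w (Ico_subset_Icc_self ht)))) h0
    (right_mem_Icc.2 hT'.1)

end Dynamics

/-! ### The quadratic form of the losses. -/

namespace Microgrid

variable {S L : Type*} [Fintype S] [Fintype L] [DecidableEq S] [DecidableEq L]
  (N : Microgrid S L)

/-- The Hessian `Y + diag (0, Y_l^*)` of the losses. -/
noncomputable def lossMatrix : Matrix (S ⊕ L) (S ⊕ L) ℝ := N.Y + Matrix.fromBlocks 0 0 0 N.YlMat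

theorem B_transpose_mulVec (x : S ⊕ L → ℝ) (e : N.graph.edgeSet) :
    (N.Bᵀ *ᵥ x) e = x (N.tail e) - x (N.head e) := by
  simp [Matrix.mulVec, dotProduct, B, sub_mul, Finset.sum_sub_distrib]

theorem Y_isSymm : N.Y.IsSymm := by
  simp [Matrix.IsSymm, Y, Matrix.transpose_mul, Matrix.mul_assoc]

/-- Conservation of current: `Bᵀ` kills constants and `Y` is symmetric. -/
theorem sum_Y_mulVec (x : S ⊕ L → ℝ) : ∑ k, (N.Y *ᵥ x) k = 0 := by
  have h1 : N.Y *ᵥ (fun _ => (1 : ℝ)) = 0 := by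
    classical
    have h : N.Bᵀ *ᵥ (fun _ => (1 : ℝ)) = 0 := by
      ext e
      simp [B_transpose_mulVec]
    rw [Y, ← Matrix.mulVec_mulVec, h, Matrix.mulVec_zero]
  have h2 : ∑ k, (N.Y *ᵥ x) k = (fun _ => (1 : ℝ)) ⬝ᵥ (N.Y *ᵥ x) := by simp [dotProduct]
  rw [h2, Matrix.dotProduct_mulVec, ← Matrix.mulVec_transpose, N.Y_isSymm.eq, h1, zero_dotProduct]

open Classical in
theorem dotProduct_Y_mulVec (x : S ⊕ L → ℝ) :
    x ⬝ᵥ (N.Y *ᵥ x) = ∑ e, (N.r e)⁻¹ * (x (N.tail e) - x (N.head e)) ^ 2 := by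
  rw [Y, ← Matrix.mulVec_mulVec, ← Matrix.mulVec_mulVec, Matrix.dotProduct_mulVec,
    ← Matrix.mulVec_transpose]
  simp only [dotProduct, Matrix.mulVec_diagonal, B_transpose_mulVec]
  refine Finset.sum_congr rfl fun e _ => by ring

theorem dotProduct_Y_mulVec_nonneg (x : S ⊕ L → ℝ) : 0 ≤ x ⬝ᵥ (N.Y *ᵥ x) := by
  classical
  rw [dotProduct_Y_mulVec]
  exact Finset.sum_nonneg fun e _ => mul_nonneg (inv_nonneg.2 (N.r_pos e).le) (sq_nonneg _)

/-- By connectedness, the kernel of `Y` consists of the constant vectors. -/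
theorem eq_of_dotProduct_Y_mulVec_eq_zero {x : S ⊕ L → ℝ} (hx : x ⬝ᵥ (N.Y *ᵥ x) = 0)
    (k l : S ⊕ L) : x k = x l := by
  classical
  rw [dotProduct_Y_mulVec, Finset.sum_eq_zero_iff_of_nonneg fun e _ =>
    mul_nonneg (inv_nonneg.2 (N.r_pos e).le) (sq_nonneg _)] at hx
  have hadj : ∀ k l, N.graph.Adj k l → x k = x l := by
    intro k l hkl
    have he := hx ⟨s(k, l), hkl⟩ (Finset.mem_univ _)
    have h0 : x (N.tail ⟨s(k, l), hkl⟩) = x (N.head ⟨s(k, l), hkl⟩) := by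
      have := (mul_eq_zero.1 he).resolve_left (inv_ne_zero (N.r_pos _).ne')
      exact sub_eq_zero.1 (pow_eq_zero_iff (two_ne_zero) |>.1 this)
    have ho := N.orientation ⟨s(k, l), hkl⟩
    rcases Sym2.eq_iff.1 ho with ⟨h1, h2⟩ | ⟨h1, h2⟩
    · rwa [h1, h2] at h0
    · rw [h1, h2] at h0
      exact h0.symm
  obtain ⟨w⟩ := N.graph_connected.preconnected k l
  induction w with
  | nil => rfl
  | cons h _ ih => exact (hadj _ _ h).trans ih

theorem Y_mulVec_inl (V : S ⊕ L → ℝ) (i : S) :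
    (N.Y *ᵥ V) (Sum.inl i) = (N.Yss *ᵥ src V + N.Ysl *ᵥ ld V) i := by
  simp [Matrix.mulVec, dotProduct, Fintype.sum_sum_type, Yss, Ysl, src, ld, Matrix.toBlocks₁₁,
    Matrix.toBlocks₁₂]

theorem Y_mulVec_inr (V : S ⊕ L → ℝ) (j : L) :
    (N.Y *ᵥ V) (Sum.inr j) = (N.Yls *ᵥ src V + N.Yll *ᵥ ld V) j := by
  simp [Matrix.mulVec, dotProduct, Fintype.sum_sum_type, Yls, Yll, src, ld, Matrix.toBlocks₂₁,
    Matrix.toBlocks₂₂]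

theorem lossMatrix_mulVec_inl (V : S ⊕ L → ℝ) (i : S) :
    (N.lossMatrix *ᵥ V) (Sum.inl i) = (N.Y *ᵥ V) (Sum.inl i) := by
  simp [lossMatrix, Matrix.add_mulVec, Matrix.fromBlocks_mulVec]

theorem lossMatrix_mulVec_inr (V : S ⊕ L → ℝ) (j : L) :
    (N.lossMatrix *ᵥ V) (Sum.inr j) = (N.Y *ᵥ V) (Sum.inr j) + N.Yl j * V (Sum.inr j) := by
  simp [lossMatrix, Matrix.add_mulVec, Matrix.fromBlocks_mulVec, YlMat, Matrix.mulVec_diagonal]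

theorem lossMatrix_isSymm : N.lossMatrix.IsSymm := by
  have h : N.YlMatᵀ = N.YlMat := Matrix.diagonal_transpose _
  simp [Matrix.IsSymm, lossMatrix, Matrix.fromBlocks_transpose, N.Y_isSymm.eq, h]

theorem dotProduct_lossMatrix_mulVec (x : S ⊕ L → ℝ) :
    x ⬝ᵥ (N.lossMatrix *ᵥ x) = x ⬝ᵥ (N.Y *ᵥ x) + ∑ j, N.Yl j * x (Sum.inr j) ^ 2 := by
  simp only [dotProduct, Fintype.sum_sum_type, lossMatrix_mulVec_inl, lossMatrix_mulVec_inr,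
    mul_add, Finset.sum_add_distrib, add_assoc]
  congr 2
  exact Finset.sum_congr rfl fun j _ => by ring

theorem dotProduct_lossMatrix_mulVec_nonneg (x : S ⊕ L → ℝ) :
    0 ≤ x ⬝ᵥ (N.lossMatrix *ᵥ x) := by
  rw [dotProduct_lossMatrix_mulVec]
  exact add_nonneg (N.dotProduct_Y_mulVec_nonneg x)
    (Finset.sum_nonneg fun j _ => mul_nonneg (N.Yl_nonneg j) (sq_nonneg _))

/-- Both parts of the form are nonnegative, hence vanish; then `x` is constant by connectedness, and
a source pins the constant to zero. -/
theorem eq_zero_of_dotProduct_lossMatrix [Nonempty S] {x : S ⊕ L → ℝ}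
    (hx : x ⬝ᵥ (N.lossMatrix *ᵥ x) = 0) (hs : src x = 0) : x = 0 := by
  have hY : x ⬝ᵥ (N.Y *ᵥ x) = 0 := by
    refine le_antisymm ?_ (N.dotProduct_Y_mulVec_nonneg x)
    rw [dotProduct_lossMatrix_mulVec] at hx
    have : 0 ≤ ∑ j, N.Yl j * x (Sum.inr j) ^ 2 :=
      Finset.sum_nonneg fun j _ => mul_nonneg (N.Yl_nonneg j) (sq_nonneg _)
    linarith
  obtain ⟨i⟩ := ‹Nonempty S›
  ext k
  rw [N.eq_of_dotProduct_Y_mulVec_eq_zero hY k (Sum.inl i)]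
  exact congrFun hs i

/-- A kernel vector, extended by zero at the sources, is annihilated by the loss form. -/
theorem loadMatrix_det_isUnit [Nonempty S] : IsUnit (N.Yll + N.YlMat).det := by
  rw [← Matrix.isUnit_iff_isUnit_det, ← Matrix.mulVec_injective_iff_isUnit,
    ← Matrix.coe_mulVecLin, injective_iff_map_eq_zero]
  intro b hb
  have hb' : (N.Yll + N.YlMat) *ᵥ b = 0 := hb
  have hx : (Sum.elim 0 b : S ⊕ L → ℝ) = 0 := by
    refine N.eq_zero_of_dotProduct_lossMatrix ?_ rfl
    have hl : ∀ j, (N.lossMatrix *ᵥ (Sum.elim 0 b : S ⊕ L → ℝ)) (Sum.inr j) = 0 := by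
      intro j
      rw [lossMatrix_mulVec_inr, Y_mulVec_inr]
      have h1 : src (Sum.elim 0 b : S ⊕ L → ℝ) = 0 := rfl
      have h2 : ld (Sum.elim 0 b : S ⊕ L → ℝ) = b := rfl
      have h3 := congrFun hb' j
      rw [Matrix.add_mulVec] at h3
      simp only [YlMat, Pi.add_apply, Matrix.mulVec_diagonal, Pi.zero_apply] at h3
      rw [h1, h2, Matrix.mulVec_zero, zero_add]
      exact h3
    simp [dotProduct, Fintype.sum_sum_type, hl]
  ext j
  exact congrFun hx (Sum.inr j)

/-- The loss form controls the loads once the sources are controlled. -/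
theorem exists_coercive [Nonempty S] : ∃ κ > 0, ∀ x : S ⊕ L → ℝ,
    κ * ‖x‖ ^ 2 ≤ x ⬝ᵥ (N.lossMatrix *ᵥ x) + ∑ i, src x i ^ 2 := by
  let q : (S ⊕ L → ℝ) → ℝ := fun x => x ⬝ᵥ (N.lossMatrix *ᵥ x) + ∑ i, src x i ^ 2
  have hq : Continuous q := by
    unfold q src
    fun_prop
  have hpos : ∀ x, x ≠ 0 → 0 < q x := by
    intro x hx
    have h1 := N.dotProduct_lossMatrix_mulVec_nonneg x
    have h2 : 0 ≤ ∑ i, src x i ^ 2 := Finset.sum_nonneg fun i _ => sq_nonneg _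
    refine lt_of_le_of_ne (add_nonneg h1 h2) fun h => hx ?_
    have h3 : x ⬝ᵥ (N.lossMatrix *ᵥ x) + ∑ i, src x i ^ 2 = 0 := h.symm
    refine N.eq_zero_of_dotProduct_lossMatrix (by linarith) ?_
    have h4 : ∑ i, src x i ^ 2 = 0 := by linarith
    rw [Finset.sum_eq_zero_iff_of_nonneg fun i _ => sq_nonneg _] at h4
    ext i
    exact pow_eq_zero_iff two_ne_zero |>.1 (h4 i (Finset.mem_univ i))
  have hhom : ∀ (a : ℝ) x, q (a • x) = a ^ 2 * q x := by
    intro a x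
    simp only [q, src, Matrix.mulVec_smul, dotProduct_smul, smul_dotProduct, Pi.smul_apply,
      smul_eq_mul, mul_pow, ← Finset.mul_sum]
    ring
  have : Nonempty (S ⊕ L) := ⟨Sum.inl (Classical.arbitrary S)⟩
  -- The constant is the minimum of `q` on the unit sphere; homogeneity of degree two does the rest.
  obtain ⟨z, hz, hmin⟩ := (isCompact_sphere (0 : S ⊕ L → ℝ) 1).exists_isMinOn
    (NormedSpace.sphere_nonempty.2 zero_le_one) hq.continuousOn
  have hz0 : z ≠ 0 := by
    rintro rfl
    simp at hz
  refine ⟨q z, hpos z hz0, fun x => ?_⟩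
  rcases eq_or_ne x 0 with rfl | hx
  · simp [src]
  · have hn : ‖x‖ ≠ 0 := norm_ne_zero_iff.2 hx
    have h1 : q z ≤ q (‖x‖⁻¹ • x) := hmin (by simp [norm_smul, hn])
    rw [hhom] at h1
    have h2 : q z * ‖x‖ ^ 2 ≤ (‖x‖⁻¹ ^ 2 * q x) * ‖x‖ ^ 2 := by gcongr
    rwa [show (‖x‖⁻¹ ^ 2 * q x) * ‖x‖ ^ 2 = q x by field_simp] at h2

end Microgrid

/-! ### Equilibria, power sharing and leaves. -/

namespace Microgrid

variable {S L : Type*} [Fintype S] [Fintype L] [DecidableEq S] [DecidableEq L]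
  (N : Microgrid S L)

theorem loadBalance_iff_lossMatrix {V : S ⊕ L → ℝ} :
    N.LoadBalance V ↔ ∀ j, (N.lossMatrix *ᵥ V) (Sum.inr j) = N.Il j := by
  rw [LoadBalance, funext_iff]
  refine forall_congr' fun j => ?_
  rw [lossMatrix_mulVec_inr, Y_mulVec_inr]
  simp only [loadCurrent, YlMat, Pi.sub_apply, Matrix.mulVec_diagonal, ld]
  constructor <;> intro h <;> linarith

theorem loadBalance_iff_ld [Nonempty S] {V : S ⊕ L → ℝ} :
    N.LoadBalance V ↔ ld V = N.loadVoltage (src V) := by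
  have hdet := N.loadMatrix_det_isUnit
  have h : N.LoadBalance V ↔ (N.Yll + N.YlMat) *ᵥ ld V = N.Il - N.Yls *ᵥ src V := by
    rw [LoadBalance, loadCurrent, Matrix.add_mulVec, sub_eq_iff_eq_add, eq_sub_iff_add_eq,
      eq_comm]
    refine Eq.congr ?_ rfl
    abel
  rw [h, loadVoltage]
  constructor
  · intro h
    rw [← h, Matrix.mulVec_mulVec, Matrix.nonsing_inv_mul _ hdet, Matrix.one_mulVec]
  · intro h
    rw [h, Matrix.mulVec_mulVec, Matrix.mul_nonsing_inv _ hdet, Matrix.one_mulVec]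

theorem Ps_eq_lossMatrix (V : S ⊕ L → ℝ) (i : S) :
    N.Ps V i = V (Sum.inl i) * (N.lossMatrix *ᵥ V) (Sum.inl i) := by
  rw [lossMatrix_mulVec_inl, Y_mulVec_inl]
  rfl

theorem sum_source_current {V : S ⊕ L → ℝ} (hV : N.LoadBalance V) :
    ∑ i, (N.lossMatrix *ᵥ V) (Sum.inl i) = -∑ j, (N.Il j - N.Yl j * V (Sum.inr j)) := by
  have h := N.sum_Y_mulVec V
  rw [Fintype.sum_sum_type] at h
  rw [loadBalance_iff_lossMatrix] at hV
  simp only [lossMatrix_mulVec_inr] at hV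
  simp only [lossMatrix_mulVec_inl]
  have h2 : ∑ j, (N.Il j - N.Yl j * V (Sum.inr j)) = ∑ j, (N.Y *ᵥ V) (Sum.inr j) :=
    Finset.sum_congr rfl fun j _ => by rw [← hV j]; ring
  linarith

theorem psStar_eq [Nonempty S] {V : S ⊕ L → ℝ} (hV : N.LoadBalance V) :
    N.psStar (src V) =
      (∑ i, (N.lossMatrix *ᵥ V) (Sum.inl i)) / ∑ i, (V (Sum.inl i))⁻¹ * N.C i := by
  rw [psStar, ← N.loadBalance_iff_ld.1 hV, N.sum_source_current hV]
  simp only [YlMat, Pi.sub_apply, Matrix.mulVec_diagonal, ld, src]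

theorem powerBalance_apply [Nonempty S] {V : S ⊕ L → ℝ} (hV : N.LoadBalance V) (i : S) :
    N.powerBalance (src V) i = N.Ps V i - N.C i * N.psStar (src V) := by
  have h := N.loadBalance_iff_ld.1 hV
  simp only [powerBalance, Ps, h, loadVoltage, YredHat, Matrix.sub_mulVec, Matrix.mulVec_sub,
    Pi.add_apply, Pi.sub_apply, ← Matrix.mulVec_mulVec]
  ring

theorem sum_inv_mul_C_pos [Nonempty S] {V : S ⊕ L → ℝ} (hV : ∀ i, 0 < src V i) :
    0 < ∑ i, (V (Sum.inl i))⁻¹ * N.C i :=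
  Finset.sum_pos (fun i _ => mul_pos (inv_pos.2 (hV i)) (N.C_pos i)) Finset.univ_nonempty

/-- Dividing by `V_i` and summing the source currents identifies `p` with `psStar`. -/
theorem mem_equilibria_of_Ps_eq [Nonempty S] {V : S ⊕ L → ℝ} (hpos : V ∈ posOrthant S L)
    (hV : N.LoadBalance V) {p : ℝ} (hP : ∀ i, N.Ps V i = N.C i * p) : V ∈ N.equilibria := by
  refine ⟨hpos, ?_, N.loadBalance_iff_ld.1 hV⟩
  ext i
  rw [N.powerBalance_apply hV, hP, N.psStar_eq hV]
  have hcur : ∀ i, (N.lossMatrix *ᵥ V) (Sum.inl i) = (V (Sum.inl i))⁻¹ * N.C i * p := by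
    intro i
    have h := hP i
    rw [Ps_eq_lossMatrix] at h
    have := (hpos (Sum.inl i)).ne'
    field_simp
    linarith
  simp only [hcur, ← Finset.sum_mul]
  rw [mul_div_cancel_left₀ _ (N.sum_inv_mul_C_pos fun i => hpos _).ne']
  simp

/-- Equilibria are the positive states with balanced loads and proportional power sharing. -/
theorem mem_equilibria_iff [Nonempty S] [Nonempty L] {V : S ⊕ L → ℝ} :
    V ∈ N.equilibria ↔ V ∈ posOrthant S L ∧ N.LoadBalance V ∧
      ∃ p > 0, ∀ i, N.Ps V i = N.C i * p := by
  constructor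
  · rintro ⟨hpos, hbal, hld⟩
    have hV := N.loadBalance_iff_ld.2 hld
    refine ⟨hpos, hV, N.psStar (src V), ?_, fun i => ?_⟩
    -- Every load draws a strictly positive current, since its constant current or its conductance
    -- is nonzero and its voltage is positive.
    · rw [N.psStar_eq hV, N.sum_source_current hV, ← Finset.sum_neg_distrib]
      refine div_pos (Finset.sum_pos (fun j _ => ?_) Finset.univ_nonempty)
        (N.sum_inv_mul_C_pos fun i => hpos _)
      have h1 := N.Il_nonpos j
      have h2 := hpos (Sum.inr j)
      have h3 := mul_nonneg (N.Yl_nonneg j) h2.le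
      rcases N.load_nonzero j with h | h
      · linarith
      · linarith [mul_pos h h2]
    · have := congrFun hbal i
      rw [N.powerBalance_apply hV] at this
      simpa [sub_eq_zero] using this
  · rintro ⟨hpos, hV, p, -, hP⟩
    exact N.mem_equilibria_of_Ps_eq hpos hV hP

theorem Ps_pos_of_mem_equilibria [Nonempty S] [Nonempty L] {V : S ⊕ L → ℝ}
    (hV : V ∈ N.equilibria) (i : S) : 0 < N.Ps V i := by
  obtain ⟨-, -, p, hp, hP⟩ := N.mem_equilibria_iff.1 hV
  rw [hP]
  exact mul_pos (N.C_pos i) hp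

theorem Lc_isSymm : N.Lcᵀ = N.Lc := by
  classical
  exact N.comm.isSymm_lapMatrix ℝ

theorem Lc_mulVec_const (p : ℝ) : N.Lc *ᵥ (fun _ => p) = 0 := by
  classical
  have h : (fun _ : S => p) = p • fun _ => (1 : ℝ) := by
    ext
    simp
  rw [h, Matrix.mulVec_smul, Lc, SimpleGraph.lapMatrix_mulVec_const_eq_zero, smul_zero]

theorem sum_Lc_mulVec (z : S → ℝ) : ∑ i, (N.Lc *ᵥ z) i = 0 := by
  have h : ∑ i, (N.Lc *ᵥ z) i = (fun _ => (1 : ℝ)) ⬝ᵥ (N.Lc *ᵥ z) := by simp [dotProduct]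
  rw [h, Matrix.dotProduct_mulVec, ← Matrix.mulVec_transpose, Lc_isSymm, Lc_mulVec_const,
    zero_dotProduct]

theorem dotProduct_Lc_mulVec_nonneg (z : S → ℝ) : 0 ≤ z ⬝ᵥ (N.Lc *ᵥ z) := by
  classical
  exact (SimpleGraph.posSemidef_lapMatrix ℝ N.comm).dotProduct_mulVec_nonneg z

theorem eq_of_dotProduct_Lc_mulVec_eq_zero {z : S → ℝ} (hz : z ⬝ᵥ (N.Lc *ᵥ z) = 0) (i k : S) :
    z i = z k := by
  classical
  have h : Matrix.toLinearMap₂' ℝ (N.comm.lapMatrix ℝ) z z = 0 := by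
    rw [Matrix.toLinearMap₂'_apply']
    exact hz
  exact (SimpleGraph.lapMatrix_toLinearMap₂'_apply'_eq_zero_iff_forall_reachable N.comm z).1 h i k
    (N.comm_connected.preconnected i k)

theorem isEquilibrium_of_mem_equilibria [Nonempty S] [Nonempty L] {V : S ⊕ L → ℝ}
    (hV : V ∈ N.equilibria) : N.IsEquilibrium V := by
  obtain ⟨hpos, hbal, p, -, hP⟩ := N.mem_equilibria_iff.1 hV
  refine ⟨hpos, ?_, hbal⟩
  have h : (fun k => (N.C k)⁻¹ * N.Ps V k) = fun _ => p := by
    ext k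
    rw [hP, inv_mul_cancel_left₀ (N.C_pos k).ne']
  ext i
  simp [sourceRHS, h, Lc_mulVec_const]

theorem dotProduct_lossMatrix_mulVec_comm (x y : S ⊕ L → ℝ) :
    x ⬝ᵥ (N.lossMatrix *ᵥ y) = y ⬝ᵥ (N.lossMatrix *ᵥ x) := by
  rw [Matrix.dotProduct_mulVec, ← Matrix.mulVec_transpose, N.lossMatrix_isSymm.eq, dotProduct_comm]

/-- The loss form of the difference of two load-balanced states only involves the sources. -/
theorem dotProduct_lossMatrix_sub {V W : S ⊕ L → ℝ} (hV : N.LoadBalance V)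
    (hW : N.LoadBalance W) (x : S ⊕ L → ℝ) :
    x ⬝ᵥ (N.lossMatrix *ᵥ (W - V)) = ∑ i, x (Sum.inl i) *
      ((N.lossMatrix *ᵥ W) (Sum.inl i) - (N.lossMatrix *ᵥ V) (Sum.inl i)) := by
  rw [loadBalance_iff_lossMatrix] at hV hW
  simp [dotProduct, Fintype.sum_sum_type, Matrix.mulVec_sub, hV, hW]

/-- In logarithmic coordinates the leaves are level sets of a linear functional. -/
theorem mem_leaf_iff {V W : S ⊕ L → ℝ} (hV : ∀ i, 0 < src V i) (hW : ∀ i, 0 < src W i) :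
    V ∈ N.leaf W ↔
      ∑ i, N.C i * Real.log (src V i) = ∑ i, N.C i * Real.log (src W i) := by
  have hprod : ∀ U : S ⊕ L → ℝ, (∀ i, 0 < src U i) →
      ∏ i, src U i ^ N.C i = Real.exp (∑ i, N.C i * Real.log (src U i)) := by
    intro U hU
    rw [Real.exp_sum]
    refine Finset.prod_congr rfl fun i _ => ?_
    rw [Real.rpow_def_of_pos (hU i), mul_comm]
  simp only [leaf, mem_ofPred_eq]
  rw [hprod V hV, hprod W hW, Real.exp_eq_exp]

/-- Each leaf of the conserved weighted geometric mean carries at most one equilibrium. -/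
theorem eq_of_mem_equilibria_of_mem_leaf [Nonempty S] [Nonempty L] {V W : S ⊕ L → ℝ}
    (hV : V ∈ N.equilibria) (hW : W ∈ N.equilibria) (hleaf : V ∈ N.leaf W) : V = W := by
  have hld : ∀ {U}, U ∈ N.equilibria → ld U = N.loadVoltage (src U) := fun h => h.2.2
  obtain ⟨hVpos, hVbal, p, hp, hPV⟩ := N.mem_equilibria_iff.1 hV
  obtain ⟨hWpos, hWbal, q, hq, hPW⟩ := N.mem_equilibria_iff.1 hW
  have hVs : ∀ i, 0 < src V i := fun i => hVpos _
  have hWs : ∀ i, 0 < src W i := fun i => hWpos _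
  rw [N.mem_leaf_iff hVs hWs] at hleaf
  have hsrc : src V = src W := by
    by_contra hne
    obtain ⟨i₀, hi₀⟩ := Function.ne_iff.1 hne
    -- Sum `log r ≤ r - 1` over the voltage ratios with weights `C_i`: the logarithms cancel on a
    -- leaf, and the inequality is strict at `i₀`.
    have hkey : ∀ {U U' : S ⊕ L → ℝ}, (∀ i, 0 < src U i) → (∀ i, 0 < src U' i) →
        src U i₀ ≠ src U' i₀ →
        ∑ i, N.C i * Real.log (src U i) = ∑ i, N.C i * Real.log (src U' i) →
        ∑ i, N.C i * (1 - src U i / src U' i) < 0 := by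
      intro U U' hU hU' hne hlog
      have hle : ∀ i, Real.log (src U i) - Real.log (src U' i) ≤ src U i / src U' i - 1 := by
        intro i
        rw [← Real.log_div (hU _).ne' (hU' _).ne']
        exact Real.log_le_sub_one_of_pos (div_pos (hU _) (hU' _))
      have hlt : Real.log (src U i₀) - Real.log (src U' i₀) < src U i₀ / src U' i₀ - 1 := by
        rw [← Real.log_div (hU _).ne' (hU' _).ne']
        refine Real.log_lt_sub_one_of_pos (div_pos (hU _) (hU' _)) ?_
        rwa [Ne, div_eq_one_iff_eq (hU' _).ne']
      have hsum : ∑ i, N.C i * (1 - src U i / src U' i) <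
          ∑ i, (N.C i * Real.log (src U' i) - N.C i * Real.log (src U i)) := by
        refine Finset.sum_lt_sum (fun i _ => ?_) ⟨i₀, Finset.mem_univ _, ?_⟩
        · nlinarith [hle i, N.C_pos i]
        · nlinarith [hlt, N.C_pos i₀]
      rw [Finset.sum_sub_distrib, hlog, sub_self] at hsum
      exact hsum
    have h1 := hkey hVs hWs hi₀ hleaf
    have h2 := hkey hWs hVs hi₀.symm hleaf.symm
    have hQ := N.dotProduct_lossMatrix_mulVec_nonneg (W - V)
    rw [N.dotProduct_lossMatrix_sub hVbal hWbal] at hQ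
    have hcur : ∀ {U : S ⊕ L → ℝ} {r : ℝ}, (∀ i, 0 < src U i) →
        (∀ i, N.Ps U i = N.C i * r) →
        ∀ i, (N.lossMatrix *ᵥ U) (Sum.inl i) = N.C i * r / src U i := by
      intro U r hU hP i
      rw [eq_div_iff (hU _).ne', ← hP, Ps_eq_lossMatrix, mul_comm]
      rfl
    -- The nonnegative loss form of `W - V` becomes a positive combination of the two negative sums
    -- `h1` and `h2`.
    have hsum : ∑ i, (W - V) (Sum.inl i) *
        ((N.lossMatrix *ᵥ W) (Sum.inl i) - (N.lossMatrix *ᵥ V) (Sum.inl i)) =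
        q * ∑ i, N.C i * (1 - src V i / src W i) + p * ∑ i, N.C i * (1 - src W i / src V i) := by
      rw [Finset.mul_sum, Finset.mul_sum, ← Finset.sum_add_distrib]
      refine Finset.sum_congr rfl fun i _ => ?_
      rw [hcur hVs hPV, hcur hWs hPW]
      have hv : src V i ≠ 0 := (hVpos _).ne'
      have hw : src W i ≠ 0 := (hWpos _).ne'
      change (src W i - src V i) * _ = _
      field_simp
      ring
    rw [hsum] at hQ
    nlinarith [mul_neg_of_pos_of_neg hq h1, mul_neg_of_pos_of_neg hp h2]
  ext k
  rcases k with i | j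
  · exact congrFun hsrc i
  · have : ld V = ld W := by rw [hld hV, hld hW, hsrc]
    exact congrFun this j

end Microgrid

/-! ### The shifted energy and its sublevel sets. -/

theorem HasDerivAt.dotProduct_mulVec_self {n : Type*} [Fintype n] (G : Matrix n n ℝ)
    {W : ℝ → n → ℝ} {W' : n → ℝ} {t : ℝ} (h : HasDerivAt W W' t) :
    HasDerivAt (fun τ => W τ ⬝ᵥ (G *ᵥ W τ)) (W' ⬝ᵥ (G *ᵥ W t) + W t ⬝ᵥ (G *ᵥ W')) t := by
  have hc := hasDerivAt_pi.1 h
  have hG : ∀ i, HasDerivAt (fun τ => (G *ᵥ W τ) i) ((G *ᵥ W') i) t := fun i =>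
    HasDerivAt.fun_sum fun j _ => (hc j).const_mul (G i j)
  have hs : HasDerivAt (fun τ => ∑ i, W τ i * (G *ᵥ W τ) i)
      (∑ i, (W' i * (G *ᵥ W t) i + W t i * (G *ᵥ W') i)) t :=
    HasDerivAt.fun_sum fun i _ => (hc i).fun_mul (hG i)
  rw [Finset.sum_add_distrib] at hs
  exact hs

namespace Microgrid

variable {S L : Type*} [Fintype S] [Fintype L] [DecidableEq S] [DecidableEq L]
  (N : Microgrid S L)

theorem losses_eq (V : S ⊕ L → ℝ) : N.losses V = (1 / 2) * (V ⬝ᵥ (N.lossMatrix *ᵥ V)) := rfl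

theorem fderiv_energy {Vbar : S ⊕ L → ℝ} (hs : ∀ i, 0 < src Vbar i) (h : S ⊕ L → ℝ) :
    fderiv ℝ (N.energy Vbar) Vbar h =
      h ⬝ᵥ (N.lossMatrix *ᵥ Vbar) - ∑ i, N.Ps Vbar i * (src h i / src Vbar i) := by
  have hdiff : DifferentiableAt ℝ (N.energy Vbar) Vbar := by
    have hne : ∀ i, Vbar (Sum.inl i) ≠ 0 := fun i => (hs i).ne'
    unfold energy losses Matrix.mulVec dotProduct src
    fun_prop (disch := exact hne _)
  have hline : HasDerivAt (fun τ : ℝ => Vbar + τ • h) h 0 := by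
    simpa using ((hasDerivAt_id (0 : ℝ)).smul_const h).const_add Vbar
  have h1 : HasDerivAt (fun τ : ℝ => N.energy Vbar (Vbar + τ • h))
      (fderiv ℝ (N.energy Vbar) Vbar h) 0 := by
    have hdiff' : HasFDerivAt (N.energy Vbar) (fderiv ℝ (N.energy Vbar) Vbar)
        (Vbar + (0 : ℝ) • h) := by simpa using hdiff.hasFDerivAt
    exact hdiff'.comp_hasDerivAt 0 hline
  have h2 : HasDerivAt (fun τ : ℝ => N.energy Vbar (Vbar + τ • h))
      (h ⬝ᵥ (N.lossMatrix *ᵥ Vbar) - ∑ i, N.Ps Vbar i * (src h i / src Vbar i)) 0 := by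
    have hq := (hline.dotProduct_mulVec_self N.lossMatrix).const_mul (1 / 2 : ℝ)
    have hlog : HasDerivAt (fun τ : ℝ => ∑ i, N.Ps Vbar i * Real.log (src (Vbar + τ • h) i))
        (∑ i, N.Ps Vbar i * (src h i / src Vbar i)) 0 := by
      refine HasDerivAt.fun_sum fun i _ => HasDerivAt.const_mul _ ?_
      have hi : HasDerivAt (fun τ : ℝ => src (Vbar + τ • h) i) (src h i) 0 :=
        hasDerivAt_pi.1 hline (Sum.inl i)
      have := hi.log (by simpa [src] using (hs i).ne')
      simpa [src] using this
    refine (hq.sub hlog).congr_deriv ?_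
    rw [zero_smul, add_zero, N.dotProduct_lossMatrix_mulVec_comm Vbar h]
    ring
  exact h1.unique h2

/-- Explicit form of the shifted energy. -/
theorem bregman_eq {Vbar : S ⊕ L → ℝ} (hs : ∀ i, 0 < src Vbar i) (V : S ⊕ L → ℝ) :
    N.bregman Vbar V = (1 / 2) * ((V - Vbar) ⬝ᵥ (N.lossMatrix *ᵥ (V - Vbar))) +
      ∑ i, N.Ps Vbar i *
        (src V i / src Vbar i - 1 - (Real.log (src V i) - Real.log (src Vbar i))) := by
  have hsum : ∑ i, N.Ps Vbar i *
        (src V i / src Vbar i - 1 - (Real.log (src V i) - Real.log (src Vbar i))) =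
      ∑ i, N.Ps Vbar i * (src (V - Vbar) i / src Vbar i) -
        ∑ i, N.Ps Vbar i * Real.log (src V i) + ∑ i, N.Ps Vbar i * Real.log (src Vbar i) := by
    rw [← Finset.sum_sub_distrib, ← Finset.sum_add_distrib]
    refine Finset.sum_congr rfl fun i _ => ?_
    have hi : src Vbar i ≠ 0 := (hs i).ne'
    have hsub : src (V - Vbar) i = src V i - src Vbar i := rfl
    rw [hsub, sub_div, div_self hi]
    ring
  rw [bregman, N.fderiv_energy hs, hsum, energy, energy, losses_eq, losses_eq]
  simp only [Matrix.mulVec_sub, dotProduct_sub, sub_dotProduct,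
    N.dotProduct_lossMatrix_mulVec_comm Vbar V]
  ring

theorem bregman_self {Vbar : S ⊕ L → ℝ} (hs : ∀ i, 0 < src Vbar i) :
    N.bregman Vbar Vbar = 0 := by
  have : ∀ i, src Vbar i ≠ 0 := fun i => (hs i).ne'
  simp [N.bregman_eq hs, this]

theorem continuousOn_bregman {Vbar : S ⊕ L → ℝ} (hs : ∀ i, 0 < src Vbar i) :
    ContinuousOn (N.bregman Vbar) {V | ∀ i, 0 < src V i} := by
  have h : N.bregman Vbar = _ := funext fun V => N.bregman_eq hs V
  rw [h]
  refine ContinuousOn.add (Continuous.continuousOn (by fun_prop)) ?_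
  refine continuousOn_finsetSum _ fun i _ => ?_
  have hsrc : ContinuousOn (fun V : S ⊕ L → ℝ => src V i) {V | ∀ i, 0 < src V i} :=
    (continuous_apply (Sum.inl i)).continuousOn
  refine ContinuousOn.mul continuousOn_const (ContinuousOn.sub ?_ (ContinuousOn.sub ?_ ?_))
  · exact (hsrc.div_const _).sub continuousOn_const
  · exact hsrc.log fun V hV => (hV i).ne'
  · exact continuousOn_const

theorem isOpen_src_pos : IsOpen {V : S ⊕ L → ℝ | ∀ i, 0 < src V i} := by
  have : {V : S ⊕ L → ℝ | ∀ i, 0 < src V i} = ⋂ i, {V | 0 < V (Sum.inl i)} := by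
    ext
    simp [src]
  rw [this]
  exact isOpen_iInter_of_finite fun i => isOpen_lt continuous_const (continuous_apply _)

/-- The function grows at least quadratically to the right and linearly to the left. With `z` a log
ratio it keeps source voltages away from both `0` and infinity. -/
theorem abs_le_add_one_of_exp_sub_le {z k : ℝ} (h : Real.exp z - 1 - z ≤ k) : |z| ≤ k + 1 := by
  have hk : 0 ≤ k := by linarith [Real.add_one_le_exp z]
  rcases le_total 0 z with hz | hz
  · rw [abs_of_nonneg hz]
    nlinarith [Real.quadratic_le_exp_of_nonneg hz, sq_nonneg (z - 1)]
  · rw [abs_of_nonpos hz]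
    linarith [Real.exp_pos z]

theorem log_ratio_nonneg {x y : ℝ} (hx : 0 < x) (hy : 0 < y) :
    0 ≤ x / y - 1 - (Real.log x - Real.log y) := by
  rw [← Real.log_div hx.ne' hy.ne']
  linarith [Real.log_le_sub_one_of_pos (div_pos hx hy)]

section Lyapunov

variable [Nonempty S] [Nonempty L] {Vbar : S ⊕ L → ℝ}

theorem src_pos_of_mem_equilibria (hVbar : Vbar ∈ N.equilibria) (i : S) : 0 < src Vbar i := hVbar.1 _

theorem bregman_terms_nonneg (hVbar : Vbar ∈ N.equilibria) {V : S ⊕ L → ℝ}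
    (hV : ∀ i, 0 < src V i) (i : S) :
    0 ≤ N.Ps Vbar i *
      (src V i / src Vbar i - 1 - (Real.log (src V i) - Real.log (src Vbar i))) :=
  mul_nonneg (N.Ps_pos_of_mem_equilibria hVbar i).le
    (log_ratio_nonneg (hV i) (N.src_pos_of_mem_equilibria hVbar i))

/-- All summands of `bregman_eq` are nonnegative, so each one alone is at most `c`. -/
theorem abs_log_sub_le (hVbar : Vbar ∈ N.equilibria) {c : ℝ} {V : S ⊕ L → ℝ}
    (hV : V ∈ N.sublevel Vbar c) (i : S) :
    |Real.log (src V i) - Real.log (src Vbar i)| ≤ c / N.Ps Vbar i + 1 := by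
  obtain ⟨hs, hc⟩ := hV
  have hsb := N.src_pos_of_mem_equilibria hVbar
  refine abs_le_add_one_of_exp_sub_le ?_
  rw [Real.exp_sub, Real.exp_log (hs i), Real.exp_log (hsb i),
    le_div_iff₀ (N.Ps_pos_of_mem_equilibria hVbar i), mul_comm]
  refine le_trans (Finset.single_le_sum (f := fun i => N.Ps Vbar i *
      (src V i / src Vbar i - 1 - (Real.log (src V i) - Real.log (src Vbar i))))
    (fun k _ => N.bregman_terms_nonneg hVbar hs k) (Finset.mem_univ i)) (le_trans ?_ hc)
  rw [N.bregman_eq hsb]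
  have := N.dotProduct_lossMatrix_mulVec_nonneg (V - Vbar)
  linarith

theorem eq_of_bregman_nonpos (hVbar : Vbar ∈ N.equilibria) {V : S ⊕ L → ℝ}
    (hs : ∀ i, 0 < src V i)
    (h : N.bregman Vbar V ≤ 0) : V = Vbar := by
  have hsb := N.src_pos_of_mem_equilibria hVbar
  rw [N.bregman_eq hsb] at h
  have h1 := N.dotProduct_lossMatrix_mulVec_nonneg (V - Vbar)
  have h2 := fun i (_ : i ∈ Finset.univ) => N.bregman_terms_nonneg hVbar hs i
  have h3 := Finset.sum_nonneg h2
  refine sub_eq_zero.1 (N.eq_zero_of_dotProduct_lossMatrix (by linarith) ?_)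
  have h4 := (Finset.sum_eq_zero_iff_of_nonneg h2).1 (le_antisymm (by linarith) h3)
  ext i
  have h5 := (mul_eq_zero.1 (h4 i (Finset.mem_univ i))).resolve_left
    (N.Ps_pos_of_mem_equilibria hVbar i).ne'
  have h6 : src V i / src Vbar i = 1 := by
    by_contra hne
    have := Real.log_lt_sub_one_of_pos (div_pos (hs i) (hsb i)) hne
    rw [Real.log_div (hs i).ne' (hsb i).ne'] at this
    linarith
  rw [div_eq_one_iff_eq (hsb i).ne'] at h6
  exact sub_eq_zero.2 h6

theorem isCompact_sublevel (hVbar : Vbar ∈ N.equilibria) (c : ℝ) : IsCompact (N.sublevel Vbar c) := by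
  have hsb := N.src_pos_of_mem_equilibria hVbar
  set k : S → ℝ := fun i => c / N.Ps Vbar i + 1 with hk
  refine Metric.isCompact_of_isClosed_isBounded ?_ ?_
  -- The domain `V_s > 0` is not closed; closedness is checked in the closed set `s` given by the
  -- lower logarithmic bound.
  · let s : Set (S ⊕ L → ℝ) := {V | ∀ i, Real.exp (Real.log (src Vbar i) - k i) ≤ src V i}
    have hs : IsClosed s := by
      have : s = ⋂ i, {V | Real.exp (Real.log (src Vbar i) - k i) ≤ V (Sum.inl i)} := by
        ext
        simp [s, src]
      rw [this]
      exact isClosed_iInter fun i => isClosed_le continuous_const (continuous_apply _)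
    have hspos : s ⊆ {V | ∀ i, 0 < src V i} := fun V hV i => (Real.exp_pos _).trans_le (hV i)
    have heq : N.sublevel Vbar c = s ∩ N.bregman Vbar ⁻¹' Iic c := by
      ext V
      constructor
      · refine fun hV => ⟨fun i => ?_, hV.2⟩
        have := (abs_le.1 (N.abs_log_sub_le hVbar hV i)).1
        rw [← Real.le_log_iff_exp_le (hV.1 i)]
        linarith
      · exact fun hV => ⟨hspos hV.1, hV.2⟩
    rw [heq]
    exact ((N.continuousOn_bregman hsb).mono hspos).preimage_isClosed_of_isClosed hs isClosed_Iic
  · obtain ⟨κ, hκ, hco⟩ := N.exists_coercive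
    set b : ℝ := (2 * c + ∑ i, (Real.exp (Real.log (src Vbar i) + k i) + src Vbar i) ^ 2) / κ
    refine (Metric.isBounded_closedBall (x := Vbar) (r := b + 1)).subset fun V hV => ?_
    rw [mem_closedBall_iff_norm]
    have h1 := hco (V - Vbar)
    have h2 : (V - Vbar) ⬝ᵥ (N.lossMatrix *ᵥ (V - Vbar)) ≤ 2 * c := by
      have h := hV.2
      rw [N.bregman_eq hsb] at h
      linarith [Finset.sum_nonneg fun i (_ : i ∈ Finset.univ) =>
        N.bregman_terms_nonneg hVbar hV.1 i]
    have h3 : ∑ i, src (V - Vbar) i ^ 2 ≤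
        ∑ i, (Real.exp (Real.log (src Vbar i) + k i) + src Vbar i) ^ 2 := by
      refine Finset.sum_le_sum fun i _ => ?_
      have h4 : src V i ≤ Real.exp (Real.log (src Vbar i) + k i) := by
        rw [← Real.log_le_iff_le_exp (hV.1 i)]
        linarith [(abs_le.1 (N.abs_log_sub_le hVbar hV i)).2]
      have h5 := hsb i
      have h6 := hV.1 i
      have h7 : src (V - Vbar) i = src V i - src Vbar i := rfl
      rw [h7]
      refine sq_le_sq' ?_ ?_ <;> linarith [Real.exp_pos (Real.log (src Vbar i) + k i)]
    have h8 : ‖V - Vbar‖ ^ 2 ≤ b := by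
      rw [le_div_iff₀ hκ]
      linarith
    nlinarith [sq_nonneg (‖V - Vbar‖ - 1)]

/-- The sublevel sets of the shifted energy form a basis of neighbourhoods of the equilibrium. -/
theorem exists_sublevel_subset (hVbar : Vbar ∈ N.equilibria)
    {U : Set (S ⊕ L → ℝ)} (hU : U ∈ 𝓝 Vbar) :
    ∃ c > 0, N.sublevel Vbar c ⊆ U := by
  have hsb := N.src_pos_of_mem_equilibria hVbar
  have hcpt : IsCompact (N.sublevel Vbar 1 \ interior U) :=
    (N.isCompact_sublevel hVbar 1).diff isOpen_interior
  rcases (N.sublevel Vbar 1 \ interior U).eq_empty_or_nonempty with he | hne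
  · exact ⟨1, one_pos, (sdiff_eq_empty.1 he).trans interior_subset⟩
  · obtain ⟨z, hz, hmin⟩ := hcpt.exists_isMinOn hne
      ((N.continuousOn_bregman hsb).mono fun V hV => hV.1.1)
    have hpos : 0 < N.bregman Vbar z := by
      by_contra! h
      have := N.eq_of_bregman_nonpos hVbar hz.1.1 h
      exact hz.2 (this ▸ mem_interior_iff_mem_nhds.2 hU)
    -- A level below the minimum of `𝓜` over the compact remainder excludes that remainder.
    refine ⟨min 1 (N.bregman Vbar z / 2), by positivity, fun V hV => ?_⟩
    by_contra hVU
    have h1 : N.bregman Vbar z ≤ N.bregman Vbar V :=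
      hmin ⟨⟨hV.1, hV.2.trans (min_le_left _ _)⟩, fun h => hVU (interior_subset h)⟩
    linarith [hV.2.trans (min_le_right _ _)]

theorem sublevel_mem_nhds (hVbar : Vbar ∈ N.equilibria) {c : ℝ} (hc : 0 < c) :
    N.sublevel Vbar c ∈ 𝓝 Vbar := by
  have hsb := N.src_pos_of_mem_equilibria hVbar
  have h1 := isOpen_src_pos.mem_nhds (show Vbar ∈ {V : S ⊕ L → ℝ | ∀ i, 0 < src V i} from hsb)
  have h2 : Tendsto (N.bregman Vbar) (𝓝 Vbar) (𝓝 0) := by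
    have h := ((N.continuousOn_bregman hsb).continuousAt h1).tendsto
    rwa [N.bregman_self hsb] at h
  filter_upwards [h1, h2.eventually_le_const hc] with V hV hV' using ⟨hV, hV'⟩

end Lyapunov

end Microgrid

/-! ### The reduced flow in logarithmic coordinates. -/

namespace Microgrid

variable {S L : Type*} [Fintype S] [Fintype L] [DecidableEq S] [DecidableEq L]
  (N : Microgrid S L)

/-- The load-balanced state with source voltages `x`. -/
noncomputable def balanced (x : S → ℝ) : S ⊕ L → ℝ := Sum.elim x (N.loadVoltage x)

/-- The load-balanced state whose source voltages have logarithms `u`. -/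
noncomputable def ofLog (u : S → ℝ) : S ⊕ L → ℝ := N.balanced fun i => Real.exp (u i)

/-- The closed-loop vector field in terms of the source voltages. -/
noncomputable def sourceField (x : S → ℝ) : S → ℝ := fun i =>
  (N.C i)⁻¹ * N.sourceRHS (N.balanced x) i

/-- The closed-loop vector field in terms of the logarithms of the source voltages. -/
noncomputable def logField (u : S → ℝ) : S → ℝ := fun i =>
  -((N.C i)⁻¹ * (N.Lc *ᵥ fun k => (N.C k)⁻¹ * N.Ps (N.ofLog u) k) i)

@[simp] theorem src_balanced (x : S → ℝ) : src (N.balanced x) = x := rfl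

@[simp] theorem src_ofLog (u : S → ℝ) : src (N.ofLog u) = fun i => Real.exp (u i) := rfl

theorem src_ofLog_pos (u : S → ℝ) (i : S) : 0 < src (N.ofLog u) i := Real.exp_pos _

theorem contDiff_balanced : ContDiff ℝ 1 N.balanced := by
  refine contDiff_pi.2 fun k => ?_
  rcases k with i | j
  · exact contDiff_apply ℝ ℝ i
  · change ContDiff ℝ 1 fun x : S → ℝ => N.loadVoltage x j
    unfold loadVoltage Matrix.mulVec dotProduct
    simp only [Pi.sub_apply]
    fun_prop

theorem contDiff_ofLog : ContDiff ℝ 1 N.ofLog :=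
  N.contDiff_balanced.comp (contDiff_pi.2 fun i => (contDiff_apply ℝ ℝ i).exp)

theorem contDiff_Ps (i : S) : ContDiff ℝ 1 fun V => N.Ps V i := by
  unfold Ps Matrix.mulVec dotProduct src ld
  simp only [Pi.add_apply]
  fun_prop

theorem contDiff_logField : ContDiff ℝ 1 N.logField := by
  have h := fun k => (N.contDiff_Ps k).comp N.contDiff_ofLog
  simp only [Function.comp_def] at h
  unfold logField Matrix.mulVec dotProduct
  fun_prop

theorem contDiff_sourceField : ContDiff ℝ 1 N.sourceField := by
  have h := fun k => (N.contDiff_Ps k).comp N.contDiff_balanced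
  simp only [Function.comp_def] at h
  unfold sourceField sourceRHS Matrix.mulVec dotProduct
  simp only [src_balanced]
  fun_prop

section Nonempty

variable [Nonempty S]

theorem loadBalance_balanced (x : S → ℝ) : N.LoadBalance (N.balanced x) :=
  N.loadBalance_iff_ld.2 rfl

theorem loadBalance_ofLog (u : S → ℝ) : N.LoadBalance (N.ofLog u) := N.loadBalance_balanced _

theorem balanced_src {V : S ⊕ L → ℝ} (hV : N.LoadBalance V) : N.balanced (src V) = V := by
  rw [loadBalance_iff_ld] at hV
  ext k
  rcases k with i | j
  · rfl
  · exact (congrFun hV j).symm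

theorem ofLog_log {V : S ⊕ L → ℝ} (hV : N.LoadBalance V) (hs : ∀ i, 0 < src V i) :
    N.ofLog (fun i => Real.log (src V i)) = V := by
  simp only [ofLog, Real.exp_log (hs _)]
  exact N.balanced_src hV

/-- Solutions of the closed-loop system are determined by their initial state. -/
theorem IsSolution.eqOn {N : Microgrid S L} {T : ℝ} {V W : ℝ → S ⊕ L → ℝ}
    (hV : N.IsSolution (Ico 0 T) V) (hW : N.IsSolution (Ico 0 T) W) (h0 : V 0 = W 0) :
    EqOn V W (Ico 0 T) := by
  have key : ∀ {U : ℝ → S ⊕ L → ℝ}, N.IsSolution (Ico 0 T) U → ∀ t ∈ Ico 0 T,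
      HasDerivWithinAt (fun τ => src (U τ)) (N.sourceField (src (U t))) (Ico 0 T) t := by
    intro U hU t ht
    refine hasDerivWithinAt_pi.2 fun i => ?_
    have h := (hU.source t ht i).const_mul (N.C i)⁻¹
    simp only [inv_mul_cancel_left₀ (N.C_pos i).ne'] at h
    rwa [sourceField, N.balanced_src (hU.load t ht)]
  intro t ht
  -- Uniqueness uses source voltages, not logarithms: an arbitrary solution is not known to stay
  -- positive.
  have h := N.contDiff_sourceField.eqOn_Ico_of_hasDerivWithinAt (key hV) (key hW)
    (congrArg src h0) ht
  rw [← N.balanced_src (hV.load t ht), ← N.balanced_src (hW.load t ht)]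
  exact congrArg N.balanced h

theorem isSolution_ofLog {u : ℝ → S → ℝ} (hu : ∀ t, 0 ≤ t → HasDerivAt u (N.logField (u t)) t) :
    N.IsSolution (Ici 0) fun t => N.ofLog (u t) := by
  refine ⟨fun t ht i => ?_, fun t _ => N.loadBalance_ofLog _⟩
  have h := ((hasDerivAt_pi.1 (hu t ht) i).exp.const_mul (N.C i)).hasDerivWithinAt (s := Ici 0)
  refine h.congr_deriv ?_
  have := (N.C_pos i).ne'
  simp only [logField, sourceRHS, src_ofLog]
  field_simp

theorem IsSolution.mono {N : Microgrid S L} {J J' : Set ℝ} {V : ℝ → S ⊕ L → ℝ}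
    (hV : N.IsSolution J V) (hJ : J' ⊆ J) : N.IsSolution J' V :=
  ⟨fun t ht i => (hV.source t (hJ ht) i).mono hJ, fun t ht => hV.load t (hJ ht)⟩

/-- The entries of `L_c z` sum to zero, so `∑ C_i u_i` is conserved. -/
theorem ofLog_mem_leaf {u : ℝ → S → ℝ} (hu : ∀ t, 0 ≤ t → HasDerivAt u (N.logField (u t)) t)
    {t : ℝ} (ht : 0 ≤ t) : N.ofLog (u t) ∈ N.leaf (N.ofLog (u 0)) := by
  rw [N.mem_leaf_iff (N.src_ofLog_pos _) (N.src_ofLog_pos _)]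
  simp only [src_ofLog, Real.log_exp]
  have hd : ∀ s, 0 ≤ s → HasDerivAt (fun τ => ∑ i, N.C i * u τ i) 0 s := by
    intro s hs
    have h : HasDerivAt (fun τ => ∑ i, N.C i * u τ i) (∑ i, N.C i * N.logField (u s) i) s :=
      HasDerivAt.fun_sum fun i _ => (hasDerivAt_pi.1 (hu s hs) i).const_mul _
    refine h.congr_deriv ?_
    rw [← neg_zero, ← N.sum_Lc_mulVec fun k => (N.C k)⁻¹ * N.Ps (N.ofLog (u s)) k,
      ← Finset.sum_neg_distrib]
    refine Finset.sum_congr rfl fun i _ => ?_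
    rw [logField, mul_neg, mul_inv_cancel_left₀ (N.C_pos i).ne']
  exact constant_of_has_deriv_right_zero
    (fun s hs => (hd s hs.1).continuousAt.continuousWithinAt)
    (fun s hs => (hd s hs.1).hasDerivWithinAt) t (right_mem_Icc.2 ht)

end Nonempty

section Lyapunov

variable [Nonempty S] [Nonempty L] {Vbar : S ⊕ L → ℝ}

theorem differentiable_bregman_ofLog (hVbar : Vbar ∈ N.equilibria) :
    Differentiable ℝ fun u => N.bregman Vbar (N.ofLog u) := by
  have h1 : Differentiable ℝ N.ofLog := N.contDiff_ofLog.differentiable one_ne_zero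
  have h2 : ∀ k, Differentiable ℝ fun u => N.ofLog u k := fun k => differentiable_pi.1 h1 k
  simp only [N.bregman_eq (N.src_pos_of_mem_equilibria hVbar), src_ofLog, Real.log_exp,
    dotProduct, Matrix.mulVec, Pi.sub_apply]
  fun_prop

/-- Load entries drop out because both states balance the loads. At the sources, the terms with the
equilibrium current `P̄_i / V̄_i` cancel between the quadratic and the logarithmic part. -/
theorem fderiv_bregman_ofLog (hVbar : Vbar ∈ N.equilibria) (u v : S → ℝ) :
    fderiv ℝ (fun u => N.bregman Vbar (N.ofLog u)) u v =
      ∑ i, (N.Ps (N.ofLog u) i - N.Ps Vbar i) * v i := by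
  have hsb := N.src_pos_of_mem_equilibria hVbar
  have hbal := (N.mem_equilibria_iff.1 hVbar).2.1
  have hline : HasDerivAt (fun τ : ℝ => u + τ • v) v 0 := by
    simpa using ((hasDerivAt_id (0 : ℝ)).smul_const v).const_add u
  have hu0 : u + (0 : ℝ) • v = u := by simp
  have h1 : HasDerivAt (fun τ : ℝ => N.bregman Vbar (N.ofLog (u + τ • v)))
      (fderiv ℝ (fun u => N.bregman Vbar (N.ofLog u)) u v) 0 := by
    have h := (N.differentiable_bregman_ofLog hVbar (u + (0 : ℝ) • v)).hasFDerivAt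
    have h' := h.comp_hasDerivAt 0 hline
    rwa [hu0] at h'
  have hW : ∃ W' : S ⊕ L → ℝ, HasDerivAt (fun τ : ℝ => N.ofLog (u + τ • v)) W' 0 := by
    have h := (N.contDiff_ofLog.differentiable one_ne_zero (u + (0 : ℝ) • v)).hasFDerivAt
    exact ⟨_, HasFDerivAt.comp_hasDerivAt (l := N.ofLog) 0 h hline⟩
  obtain ⟨W', hW⟩ := hW
  have hexp : ∀ i, HasDerivAt (fun τ : ℝ => Real.exp ((u + τ • v) i)) (Real.exp (u i) * v i) 0 := by
    intro i
    have h := (hasDerivAt_pi.1 hline i).exp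
    rwa [hu0] at h
  have hW' : ∀ i, W' (Sum.inl i) = Real.exp (u i) * v i := fun i =>
    (hasDerivAt_pi.1 hW (Sum.inl i)).unique (hexp i)
  have hq := ((hW.sub_const Vbar).dotProduct_mulVec_self N.lossMatrix).const_mul (1 / 2 : ℝ)
  have hlog : HasDerivAt (fun τ : ℝ => ∑ i, N.Ps Vbar i *
      (Real.exp ((u + τ • v) i) / src Vbar i - 1 - ((u + τ • v) i - Real.log (src Vbar i))))
      (∑ i, N.Ps Vbar i * (Real.exp (u i) * v i / src Vbar i - v i)) 0 :=
    HasDerivAt.fun_sum fun i _ => HasDerivAt.const_mul _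
      ((((hexp i).div_const _).sub_const _).sub ((hasDerivAt_pi.1 hline i).sub_const _))
  have h2 : HasDerivAt (fun τ : ℝ => N.bregman Vbar (N.ofLog (u + τ • v)))
      (∑ i, (N.Ps (N.ofLog u) i - N.Ps Vbar i) * v i) 0 := by
    simp only [N.bregman_eq hsb, src_ofLog, Real.log_exp]
    refine (hq.add hlog).congr_deriv ?_
    rw [hu0, N.dotProduct_lossMatrix_mulVec_comm (N.ofLog u - Vbar) W',
      N.dotProduct_lossMatrix_sub hbal (N.loadBalance_ofLog u), ← two_mul, ← mul_assoc,
      one_div_mul_cancel two_ne_zero, one_mul, ← Finset.sum_add_distrib]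
    refine Finset.sum_congr rfl fun i _ => ?_
    have hx : N.ofLog u (Sum.inl i) = Real.exp (u i) := rfl
    have hi : Vbar (Sum.inl i) ≠ 0 := (hsb i).ne'
    rw [hW', N.Ps_eq_lossMatrix (N.ofLog u), N.Ps_eq_lossMatrix Vbar, hx, src]
    field_simp
    ring
  exact h1.unique h2

theorem fderiv_bregman_logField (hVbar : Vbar ∈ N.equilibria) (u : S → ℝ) :
    fderiv ℝ (fun u => N.bregman Vbar (N.ofLog u)) u (N.logField u) =
      -((fun k => (N.C k)⁻¹ * N.Ps (N.ofLog u) k) ⬝ᵥ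
        (N.Lc *ᵥ fun k => (N.C k)⁻¹ * N.Ps (N.ofLog u) k)) := by
  obtain ⟨-, -, p, -, hP⟩ := N.mem_equilibria_iff.1 hVbar
  rw [N.fderiv_bregman_ofLog hVbar]
  set z : S → ℝ := fun k => (N.C k)⁻¹ * N.Ps (N.ofLog u) k with hz
  have h : ∀ i, (N.Ps (N.ofLog u) i - N.Ps Vbar i) * N.logField u i =
      p * (N.Lc *ᵥ z) i - z i * (N.Lc *ᵥ z) i := by
    intro i
    have := (N.C_pos i).ne'
    simp only [logField, hP, ← hz]
    simp only [hz]
    field_simp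
    ring
  rw [Finset.sum_congr rfl fun i _ => h i, Finset.sum_sub_distrib, ← Finset.mul_sum,
    N.sum_Lc_mulVec, mul_zero, zero_sub]
  rfl

theorem fderiv_bregman_logField_nonpos (hVbar : Vbar ∈ N.equilibria) (u : S → ℝ) :
    fderiv ℝ (fun u => N.bregman Vbar (N.ofLog u)) u (N.logField u) ≤ 0 := by
  rw [N.fderiv_bregman_logField hVbar, neg_nonpos]
  exact N.dotProduct_Lc_mulVec_nonneg _

theorem continuous_fderiv_bregman_logField (hVbar : Vbar ∈ N.equilibria) :
    Continuous fun u => fderiv ℝ (fun u => N.bregman Vbar (N.ofLog u)) u (N.logField u) := by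
  have h := fun k => ((N.contDiff_Ps k).comp N.contDiff_ofLog).continuous
  simp only [Function.comp_def] at h
  simp only [N.fderiv_bregman_logField hVbar, dotProduct, Matrix.mulVec]
  fun_prop

theorem ofLog_mem_equilibria {u : S → ℝ} (hVbar : Vbar ∈ N.equilibria)
    (hpos : N.ofLog u ∈ posOrthant S L)
    (h : fderiv ℝ (fun u => N.bregman Vbar (N.ofLog u)) u (N.logField u) = 0) :
    N.ofLog u ∈ N.equilibria := by
  rw [N.fderiv_bregman_logField hVbar, neg_eq_zero] at h
  have hz := N.eq_of_dotProduct_Lc_mulVec_eq_zero h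
  obtain ⟨i₀⟩ := ‹Nonempty S›
  have hP : ∀ i, N.Ps (N.ofLog u) i = N.C i * ((N.C i₀)⁻¹ * N.Ps (N.ofLog u) i₀) := by
    intro i
    rw [← hz i i₀, mul_inv_cancel_left₀ (N.C_pos i).ne']
  exact N.mem_equilibria_of_Ps_eq hpos (N.loadBalance_ofLog u) hP

theorem isCompact_bregman_ofLog_le (hVbar : Vbar ∈ N.equilibria) (c : ℝ) :
    IsCompact {u | N.bregman Vbar (N.ofLog u) ≤ c} := by
  have hclosed : IsClosed {u | N.bregman Vbar (N.ofLog u) ≤ c} :=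
    isClosed_le (N.differentiable_bregman_ofLog hVbar).continuous continuous_const
  refine (isCompact_univ_pi fun i : S => isCompact_Icc
    (a := Real.log (src Vbar i) - (c / N.Ps Vbar i + 1))
    (b := Real.log (src Vbar i) + (c / N.Ps Vbar i + 1))).of_isClosed_subset hclosed ?_
  intro u hu i _
  have h := abs_le.1 (N.abs_log_sub_le hVbar (V := N.ofLog u) ⟨N.src_ofLog_pos u, hu⟩ i)
  simp only [src_ofLog, Real.log_exp] at h
  constructor <;> linarith

end Lyapunov

end Microgrid

/-! ### Convergence and stability. -/

namespace Microgrid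

variable {S L : Type*} [Fintype S] [Fintype L] [DecidableEq S] [DecidableEq L]
  [Nonempty S] [Nonempty L] (N : Microgrid S L) {Vbar : S ⊕ L → ℝ}

theorem bregman_ofLog_antitoneOn (hVbar : Vbar ∈ N.equilibria) {u : ℝ → S → ℝ}
    (hu : ∀ t, 0 ≤ t → HasDerivAt u (N.logField (u t)) t) :
    AntitoneOn (fun t => N.bregman Vbar (N.ofLog (u t))) (Ici 0) := by
  have hd : ∀ t, 0 ≤ t → HasDerivAt (fun τ => N.bregman Vbar (N.ofLog (u τ)))
      (fderiv ℝ (fun u => N.bregman Vbar (N.ofLog u)) (u t) (N.logField (u t))) t := fun t ht =>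
    HasFDerivAt.comp_hasDerivAt (l := fun u => N.bregman Vbar (N.ofLog u)) t
      (N.differentiable_bregman_ofLog hVbar (u t)).hasFDerivAt (hu t ht)
  refine antitoneOn_of_deriv_nonpos (convex_Ici 0)
    (fun t ht => (hd t ht).continuousAt.continuousWithinAt)
    (fun t ht => ?_) (fun t ht => ?_)
  · rw [interior_Ici] at ht
    exact (hd t (le_of_lt ht)).differentiableAt.differentiableWithinAt
  · rw [interior_Ici] at ht
    rw [(hd t (le_of_lt ht)).deriv]
    exact N.fderiv_bregman_logField_nonpos hVbar _

/-- Balanced initial states in a sublevel set of the shifted energy have a global forward solution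
that stays in the sublevel set. -/
theorem exists_log_solution (hVbar : Vbar ∈ N.equilibria) {c : ℝ} {V₀ : S ⊕ L → ℝ}
    (hV₀ : V₀ ∈ N.sublevel Vbar c) (hbal : N.LoadBalance V₀) :
    ∃ u : ℝ → S → ℝ, N.ofLog (u 0) = V₀ ∧
      (∀ t, 0 ≤ t → HasDerivAt u (N.logField (u t)) t) ∧
      ∀ t, 0 ≤ t → N.ofLog (u t) ∈ N.sublevel Vbar c := by
  obtain ⟨u, hu0, hu, hle⟩ := exists_forward_solution_of_lyapunov N.contDiff_logField
    (N.differentiable_bregman_ofLog hVbar) (N.fderiv_bregman_logField_nonpos hVbar)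
    (x₀ := fun i => Real.log (src V₀ i)) (N.isCompact_bregman_ofLog_le hVbar _)
  have h0 := N.ofLog_log hbal hV₀.1
  refine ⟨u, by rw [hu0, h0], hu, fun t ht => ⟨N.src_ofLog_pos _, (hle t ht).trans ?_⟩⟩
  rw [h0]
  exact hV₀.2

theorem IsSolution.eqOn_ofLog {N : Microgrid S L} {T : ℝ} {W : ℝ → S ⊕ L → ℝ} {u : ℝ → S → ℝ}
    (hW : N.IsSolution (Ico 0 T) W) (hu : ∀ t, 0 ≤ t → HasDerivAt u (N.logField (u t)) t)
    (h0 : W 0 = N.ofLog (u 0)) : EqOn W (fun t => N.ofLog (u t)) (Ico 0 T) :=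
  hW.eqOn ((N.isSolution_ofLog hu).mono Ico_subset_Ici_self) h0

/-- A forward solution inside a sublevel set of positive states converges to an equilibrium on
its leaf. -/
theorem exists_tendsto_ofLog (hVbar : Vbar ∈ N.equilibria) {c : ℝ}
    (hc : N.sublevel Vbar c ⊆ posOrthant S L) {u : ℝ → S → ℝ}
    (hu : ∀ t, 0 ≤ t → HasDerivAt u (N.logField (u t)) t)
    (hmem : ∀ t, 0 ≤ t → N.ofLog (u t) ∈ N.sublevel Vbar c) :
    ∃ Ve ∈ N.equilibria, Ve ∈ N.sublevel Vbar c ∧ Ve ∈ N.leaf (N.ofLog (u 0)) ∧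
      Tendsto (fun t => N.ofLog (u t)) atTop (𝓝 Ve) := by
  obtain ⟨x, hx, hx0, s, hs, hlim⟩ := exists_limit_point_orbital_deriv_eq_zero
    (N.differentiable_bregman_ofLog hVbar) (N.fderiv_bregman_logField_nonpos hVbar)
    (N.continuous_fderiv_bregman_logField hVbar) hu (N.isCompact_bregman_ofLog_le hVbar c)
    (fun t ht => (hmem t ht).2)
  have hxsub : N.ofLog x ∈ N.sublevel Vbar c := ⟨N.src_ofLog_pos x, hx⟩
  -- The inclusion `hc` is what makes the load voltages of the limit positive.
  have hxeq : N.ofLog x ∈ N.equilibria := N.ofLog_mem_equilibria hVbar (hc hxsub) hx0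
  refine ⟨N.ofLog x, hxeq, hxsub, ?_, ?_⟩
  · rw [N.mem_leaf_iff (N.src_ofLog_pos _) (N.src_ofLog_pos _)]
    simp only [src_ofLog, Real.log_exp]
    have hcont : Continuous fun v : S → ℝ => ∑ i, N.C i * v i := by fun_prop
    refine tendsto_nhds_unique ((hcont.tendsto x).comp hlim)
      (tendsto_const_nhds.congr' ?_)
    filter_upwards [hs.eventually_ge_atTop 0] with n hn
    have h := N.ofLog_mem_leaf hu hn
    rw [N.mem_leaf_iff (N.src_ofLog_pos _) (N.src_ofLog_pos _)] at h
    simpa using h.symm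
  · intro U hU
    -- The energy is now centred at the limit point; one visit to its sublevel set at level `d`
    -- traps the orbit in `U`.
    obtain ⟨d, hd, hsub⟩ := N.exists_sublevel_subset hxeq hU
    have hnear : ∀ᶠ n in atTop, N.ofLog (u (s n)) ∈ N.sublevel (N.ofLog x) d :=
      ((N.contDiff_ofLog.continuous.tendsto x).comp hlim).eventually
        (N.sublevel_mem_nhds hxeq hd)
    obtain ⟨n, hn, hn0⟩ := (hnear.and (hs.eventually_ge_atTop 0)).exists
    rw [mem_map]
    filter_upwards [eventually_ge_atTop (s n)] with t ht
    refine hsub ⟨N.src_ofLog_pos _, le_trans ?_ hn.2⟩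
    exact N.bregman_ofLog_antitoneOn hxeq hu hn0 (hn0.trans ht) ht

theorem posOrthant_mem_nhds {V : S ⊕ L → ℝ} (hV : V ∈ posOrthant S L) :
    posOrthant S L ∈ 𝓝 V := by
  have : posOrthant S L = ⋂ k, {V | 0 < V k} := by
    ext
    simp [posOrthant]
  rw [this] at hV ⊢
  exact (isOpen_iInter_of_finite fun k =>
    isOpen_lt continuous_const (continuous_apply k)).mem_nhds hV

theorem lyapunovStable_of_mem_equilibria {Ve : S ⊕ L → ℝ} (hVe : Ve ∈ N.equilibria) :
    N.LyapunovStable Ve := by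
  intro ε hε
  obtain ⟨c, hc, hsub⟩ := N.exists_sublevel_subset hVe (Metric.ball_mem_nhds Ve hε)
  obtain ⟨δ, hδ, hball⟩ := Metric.mem_nhds_iff.1 (N.sublevel_mem_nhds hVe hc)
  refine ⟨δ, hδ, fun T V hV h0 t ht => ?_⟩
  have h0T : (0 : ℝ) ∈ Ico 0 T := ⟨le_rfl, ht.1.trans_lt ht.2⟩
  obtain ⟨u, hu0, hu, hmem⟩ := N.exists_log_solution hVe (hball h0) (hV.load 0 h0T)
  rw [hV.eqOn_ofLog hu hu0.symm ht]
  exact hsub (hmem t ht.1)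

theorem asymptoticallyStable_of_mem_equilibria {Ve : S ⊕ L → ℝ} (hVe : Ve ∈ N.equilibria) :
    N.AsymptoticallyStable Ve := by
  refine ⟨N.isEquilibrium_of_mem_equilibria hVe, N.lyapunovStable_of_mem_equilibria hVe, ?_⟩
  -- Centring at `Ve` with a small level keeps the sublevel set in the positive orthant, as
  -- `exists_tendsto_ofLog` requires.
  obtain ⟨c, hc, hsub⟩ := N.exists_sublevel_subset hVe (posOrthant_mem_nhds hVe.1)
  obtain ⟨δ, hδ, hball⟩ := Metric.mem_nhds_iff.1 (N.sublevel_mem_nhds hVe hc)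
  refine ⟨δ, hδ, fun V hV hleaf h0 => ?_⟩
  obtain ⟨u, hu0, hu, hmem⟩ := N.exists_log_solution hVe (hball h0) (hV.load 0 self_mem_Ici)
  obtain ⟨W, hW, -, hWleaf, hlim⟩ := N.exists_tendsto_ofLog hVe hsub hu hmem
  have hWVe : W = Ve := by
    refine N.eq_of_mem_equilibria_of_mem_leaf hW hVe ?_
    rw [hu0] at hWleaf
    exact Eq.trans hWleaf hleaf
  rw [hWVe] at hlim
  refine hlim.congr' ?_
  filter_upwards [eventually_ge_atTop 0] with t ht
  exact ((hV.mono Ico_subset_Ici_self).eqOn_ofLog hu hu0.symm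
    (T := t + 1) ⟨ht, lt_add_one t⟩).symm

end Microgrid

theorem theorem2 {S L : Type*} [Fintype S] [Fintype L] [DecidableEq S] [DecidableEq L]
    [Nonempty S] [Nonempty L] (N : Microgrid S L)
    (Vbar : S ⊕ L → ℝ) (hVbar : Vbar ∈ N.equilibria) :
    (∃ c > 0, IsCompact (N.sublevel Vbar c) ∧
      N.sublevel Vbar c ⊆ Microgrid.posOrthant S L) ∧
    ∀ c : ℝ, N.sublevel Vbar c ⊆ Microgrid.posOrthant S L →
      ∀ V0 ∈ N.sublevel Vbar c, N.LoadBalance V0 →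
        ∃ V : ℝ → S ⊕ L → ℝ, N.IsSolution (Ici 0) V ∧ V 0 = V0 ∧
          (∀ (T : ℝ) (W : ℝ → S ⊕ L → ℝ), N.IsSolution (Ico 0 T) W → W 0 = V0 →
            EqOn W V (Ico 0 T)) ∧
          (∀ t, 0 ≤ t → V t ∈ N.sublevel Vbar c) ∧
          ∃ Ve ∈ N.equilibria ∩ N.sublevel Vbar c ∩ N.preserved (N.sublevel Vbar c) V0,
            N.AsymptoticallyStable Ve ∧ Tendsto V atTop (𝓝 Ve) := by
  constructor
  · obtain ⟨c, hc, hsub⟩ := N.exists_sublevel_subset hVbar (Microgrid.posOrthant_mem_nhds hVbar.1)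
    exact ⟨c, hc, N.isCompact_sublevel hVbar c, hsub⟩
  · intro c hc V0 hV0 hbal
    obtain ⟨u, hu0, hu, hmem⟩ := N.exists_log_solution hVbar hV0 hbal
    obtain ⟨Ve, hVe, hVesub, hleaf, hlim⟩ := N.exists_tendsto_ofLog hVbar hc hu hmem
    rw [hu0] at hleaf
    exact ⟨fun t => N.ofLog (u t), N.isSolution_ofLog hu, hu0,
      fun T W hW hW0 => hW.eqOn_ofLog hu (hW0.trans hu0.symm), hmem,
      Ve, ⟨⟨hVe, hVesub⟩, hVesub, hleaf, hVe.2.2⟩,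
      N.asymptoticallyStable_of_mem_equilibria hVe, hlim⟩
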